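/- Let $A\in\mathbb R^{n\times n}$, $B\in\mathbb R^{n\times m}$, $C\in\mathbb R^{p\times n}$, $K\in\mathbb R^{m\times n}$, $L\in\mathbb R^{n\times p}$ be such that $A+BK$ and $A-LC$ are Hurwitz. Let $D_1,D_2:\mathbb R\to[0,\infty)$ be delay functions, $\phi_i(t)=t-D_i(t)$, and assume for $i=1,2$ that $\phi_i$ is continuously differentiable on $[0,\infty)$ and that 1. there is $\pi_0>0$ with $t-\phi_i(t)\ge\pi_0$ for all $t>0$, and $\sup_{\nu\ge\phi_i^{-1}(0)}(\nu-\phi_i(\nu))<\infty$; 2. there is $\pi_2>0$ with $\phi_i'(t)\ge\pi_2$ for all $t>0$, and $\sup_{\nu\ge\phi_i^{-1}(0)}\phi_i'(\nu)<\infty$. Here $\phi_i^{-1}$ is the inverse of $\phi_i$ on $[0,\infty)$. Let $\psi(t)=\phi_1^{-1}(t)-t$, $t\ge0$, be the exact prediction horizon. Given $\hat\psi:[0,\infty)\to\mathbb R$ (an approximate prediction horizon), consider the closed loop of the plant and measurement $$\dot Z(t)=AZ(t)+BU(\phi_1(t)),\qquad Y(t)=CZ(\phi_2(t)),$$ the observer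 and reconstruction $$\dot\xi(t)=\phi_2'(t)\bigl[A\xi(t)+BU(\phi_1(\phi_2(t)))+L(Y(t)-C\xi(t))\bigr],\qquad \hat Z(t)=e^{A(t-\phi_2(t))}\xi(t)+\int_{\phi_2(t)}^{t}e^{A(t-\tau)}BU(\phi_1(\tau))\,d\tau ,$$ and the feedback $U(t)=K\hat P(t)$, $t>0$, where the predictor is implemented with $\hat\psi$ in either one of the two causal forms $$\hat P(t)=e^{A\hat\psi(t)}\hat Z(t)+\int_t^{t+\hat\psi(t)}\mathbf 1_{\{\phi_1(s)\le t\}}\,e^{A(t+\hat\psi(t)-s)}BU(\phi_1(s))\,ds$$ (nothing is cut off when $\hat\psi(t)\le\psi(t)$), or, in terms of the distributed input $u(x,t)=U(\phi_1(t+x\psi(t)))$, $x\in[0,1]$, $$\hat P(t)=e^{A\hat\psi(t)}\hat Z(t)+\int_0^1\hat\psi(t)\,e^{A(1-x)\hat\psi(t)}Bu(x,t)\,dx .$$ For $\hat\psi=\psi$ both are the exact predictor. Solutions are understood in the Carathéodory (integrated) sense, with $U$ bounded on $[\phi_1(0),T]$ for every $T$, $U\circ\phi_1$ integrable on $[\phi_2(0),T]$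 for every $T$, and $Z,\xi$ continuous; the plant equation holds for $t\ge\phi_2(0)$, that is, the state history on $[\phi_2(0),0]$ is generated by the plant from the input history; the observer equation holds for $t\ge0$ with arbitrary $\xi(0)$. Then there exist $\epsilon^\ast>0$, $M>0$ and a positive, strictly decreasing function $c:(0,\epsilon^\ast)\to(0,\infty)$ such that for every $\epsilon\in(0,\epsilon^\ast)$, every $\hat\psi$ with $|\psi(t)-\hat\psi(t)|\le\epsilon$ for all $t\ge0$, and every solution of the closed loop, $$\Gamma(t)\le M e^{-c(\epsilon)t}\,\Gamma(0)\quad\text{for all }t\ge0,\qquad \Gamma(t):=|Z(t)|^2+|Z(t)-\hat Z(t)|^2+\sup_{\phi_1(t)\le\tau\le t}|U(\tau)|^2 .$$ -/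

import Mathlib

open Set Filter Topology MeasureTheory

noncomputable section

/-- The Euclidean space `ℝᵏ`. -/
abbrev Vec (k : ℕ) : Type := EuclideanSpace ℝ (Fin k)

/-- A real matrix acting on Euclidean column vectors. -/
def act {p q : ℕ} (M : Matrix (Fin p) (Fin q) ℝ) : Vec q →L[ℝ] Vec p :=
  LinearMap.toContinuousLinearMap (Matrix.toEuclideanLin M)

/-- The matrix exponential `e^{A τ}`, as an operator on `ℝⁿ`. -/
def expFlow {n : ℕ} (A : Matrix (Fin n) (Fin n) ℝ) (τ : ℝ) : Vec n →L[ℝ] Vec n :=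
  NormedSpace.exp (τ • act A)

/-- All complex eigenvalues of the real matrix `M` have negative real part. -/
def IsHurwitz {n : ℕ} (M : Matrix (Fin n) (Fin n) ℝ) : Prop :=
  ∀ μ ∈ spectrum ℂ (M.map (algebraMap ℝ ℂ)), μ.re < 0

/-- The delayed time `φ(t) = t - D(t)` of a delay function `D`. -/
def delayedTime (D : ℝ → ℝ) (t : ℝ) : ℝ := t - D t

/-- The inverse `φ⁻¹` of the delayed time `φ : [0, ∞) → ℝ`. -/
def delayedTimeInv (D : ℝ → ℝ) (t : ℝ) : ℝ := Function.invFunOn (delayedTime D) (Ici 0) t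

/-- The exact prediction horizon `ψ(t) = φ⁻¹(t) - t`. -/
def predictionHorizon (D : ℝ → ℝ) (t : ℝ) : ℝ := delayedTimeInv D t - t

/-- The delay is nonnegative, bounded below by a positive constant at positive times, and
bounded above on `[φ⁻¹(0), ∞)`; `φ` is continuously differentiable on `[0, ∞)`. -/
structure DelayPositiveBounded (D : ℝ → ℝ) : Prop where
  nonneg : ∀ t, 0 ≤ D t
  contDiffOn : ContDiffOn ℝ 1 (delayedTime D) (Ici 0)
  lower : ∃ π₀ > 0, ∀ t > 0, π₀ ≤ t - delayedTime D t
  upper : BddAbove ((fun ν => ν - delayedTime D ν) '' Ici (delayedTimeInv D 0))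

/-- `φ` is continuously differentiable on `[0, ∞)`, with derivative bounded below by a positive
constant at positive times and bounded above on `[φ⁻¹(0), ∞)`. -/
structure DelayInvertible (D : ℝ → ℝ) : Prop where
  contDiffOn : ContDiffOn ℝ 1 (delayedTime D) (Ici 0)
  lower : ∃ π₂ > 0, ∀ t > 0, π₂ ≤ deriv (delayedTime D) t
  upper : BddAbove (deriv (delayedTime D) '' Ici (delayedTimeInv D 0))

section Loop

variable {n m p : ℕ} (A : Matrix (Fin n) (Fin n) ℝ) (B : Matrix (Fin n) (Fin m) ℝ)
  (C : Matrix (Fin p) (Fin n) ℝ) (L : Matrix (Fin n) (Fin p) ℝ)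
  (D₁ D₂ : ℝ → ℝ)

/-- The measurement `Y(t) = C Z(φ₂(t))`. -/
def measurement (Z : ℝ → Vec n) (t : ℝ) : Vec p := act C (Z (delayedTime D₂ t))

/-- Plant and observer in Carathéodory (integrated) form, for an input signal `U`.
The plant equation `Z' = A Z + B U(φ₁(·))` holds on `[φ₂(0), ∞)`: the state history on
`[φ₂(0), 0]`, which is what is measured at first, is itself produced by the plant. -/
structure PlantObserver (Z : ℝ → Vec n) (U : ℝ → Vec m) (ξ : ℝ → Vec n) : Prop where
  input_integrable : ∀ T, delayedTime D₂ 0 ≤ T →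
    IntervalIntegrable (fun τ => U (delayedTime D₁ τ)) volume (delayedTime D₂ 0) T
  input_bounded : ∀ T, BddAbove ((fun τ => ‖U τ‖) '' Icc (delayedTime D₁ 0) T)
  state_continuous : ContinuousOn Z (Ici (delayedTime D₂ 0))
  plant : ∀ t, delayedTime D₂ 0 ≤ t →
    Z t = Z (delayedTime D₂ 0) +
      ∫ τ in (delayedTime D₂ 0)..t, (act A (Z τ) + act B (U (delayedTime D₁ τ)))
  observer_continuous : ContinuousOn ξ (Ici 0)
  observer : ∀ t, 0 ≤ t →
    ξ t = ξ 0 + ∫ s in (0 : ℝ)..t, deriv (delayedTime D₂) s •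
      (act A (ξ s) + act B (U (delayedTime D₁ (delayedTime D₂ s))) +
        act L (measurement C D₂ Z s - act C (ξ s)))

/-- The reconstruction `Ẑ(t) = e^{A(t-φ₂(t))} ξ(t) + ∫_{φ₂(t)}^t e^{A(t-τ)} B U(φ₁(τ)) dτ`. -/
def reconstruction (U : ℝ → Vec m) (ξ : ℝ → Vec n) (t : ℝ) : Vec n :=
  expFlow A (t - delayedTime D₂ t) (ξ t) +
    ∫ τ in (delayedTime D₂ t)..t, expFlow A (t - τ) (act B (U (delayedTime D₁ τ)))

open Classical in
/-- The predictor with horizon `ψh`,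
`P̂(t) = e^{A ψh(t)} Ẑ(t) + ∫_t^{t+ψh(t)} e^{A(t+ψh(t)-s)} B U(φ₁(s)) ds`,
where input values at times `φ₁(s) > t`, which are not available at time `t`, are left out.
Nothing is left out at times with `ψh(t) ≤ ψ(t)`. -/
def predictor (ψh : ℝ → ℝ) (U : ℝ → Vec m) (ξ : ℝ → Vec n) (t : ℝ) : Vec n :=
  expFlow A (ψh t) (reconstruction A B D₁ D₂ U ξ t) +
    ∫ s in t..(t + ψh t),
      if delayedTime D₁ s ≤ t then expFlow A (t + ψh t - s) (act B (U (delayedTime D₁ s))) else 0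

/-- The predictor with horizon `ψh` written through the distributed actuator state
`u(x,t) = U(φ₁(t + x ψ(t)))`, `0 ≤ x ≤ 1`:
`P̂(t) = e^{A ψh(t)} Ẑ(t) + ∫_0^1 ψh(t) e^{A(1-x)ψh(t)} B u(x,t) dx`. -/
def distributedPredictor (ψh : ℝ → ℝ) (U : ℝ → Vec m) (ξ : ℝ → Vec n) (t : ℝ) : Vec n :=
  expFlow A (ψh t) (reconstruction A B D₁ D₂ U ξ t) +
    ∫ x in (0 : ℝ)..1, ψh t • expFlow A ((1 - x) * ψh t)
      (act B (U (delayedTime D₁ (t + x * predictionHorizon D₁ t))))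

/-- Solutions of the closed loop in which the predictor is implemented, in either of the two
forms above, with the horizon `ψh` and the nominal gain `K`. The input on `t ≤ 0` is initial
data; the feedback law determines it for `t > 0`. -/
def IsClosedLoopSolution (K : Matrix (Fin m) (Fin n) ℝ) (ψh : ℝ → ℝ)
    (Z : ℝ → Vec n) (U : ℝ → Vec m) (ξ : ℝ → Vec n) : Prop :=
  PlantObserver A B C L D₁ D₂ Z U ξ ∧
    ((∀ t > 0, U t = act K (predictor A B D₁ D₂ ψh U ξ t)) ∨
      (∀ t > 0, U t = act K (distributedPredictor A B D₁ D₂ ψh U ξ t)))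

/-- `Γ(t) = |Z(t)|² + |Z(t) - Ẑ(t)|² + sup_{φ₁(t) ≤ τ ≤ t} |U(τ)|²`. -/
def Gam (Z : ℝ → Vec n) (U : ℝ → Vec m) (ξ : ℝ → Vec n) (t : ℝ) : ℝ :=
  ‖Z t‖ ^ 2 + ‖Z t - reconstruction A B D₁ D₂ U ξ t‖ ^ 2 +
    sSup ((fun τ => ‖U τ‖ ^ 2) '' Icc (delayedTime D₁ t) t)

end Loop

end

/-!
The state at the prediction time is known exactly: by variation of constants
`Z(φ₁⁻¹(t)) = e^{Aψ(t)} Z(t) + ∫_t^{t+ψ(t)} e^{A(t+ψ(t)-s)} B U(φ₁(s)) ds`. Comparing this with either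
form of the implemented predictor (`exists_feedback_error_le`) shows that `U(t)` is the nominal
feedback `K Z(φ₁⁻¹(t))` up to an error of size `ε` relative to `|Z(t)|` and to the input on
`[φ₁(t), t]`, plus a multiple of the reconstruction error `|Z(t) - Ẑ(t)|`.

The reconstruction error is autonomous. The error `e(t) = Z(φ₂(t)) - ξ(t)` satisfies
`e' = φ₂' (A - LC) e`, so `e(t) = e^{(A-LC)(φ₂(t)-φ₂(0))} e(0)`
(`PlantObserver.observer_error_eq`), and `Z - Ẑ = e^{A(t-φ₂(t))} e`; as the delay is bounded, both
decay exponentially (`exists_reconstruction_error_le`).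

Once the feedback has reached the plant, `Z' = (A + BK) Z + B d`, with `d` the feedback error at the
delayed time. In sup norms weighted by `e^{cs}`, with `c` below the decay rates of `A + BK` and
`A - LC`, the map from `d` to `(Z, U)` is bounded, and the part of `d` depending on `(Z, U)` has gain
`O(ε)`; a small-gain argument (`exists_exponential_bound`) closes the estimate. It works on a
finite window `[0, T]`, where the weighted norms are finite, and gives constants independent of `T`
and `ε`; in particular the rate obtained is uniform for all small `ε`.

Two general facts are proved on the way: the exponential decay of `e^{Mt}` for Hurwitz `M`
(`IsHurwitz.exists_norm_expFlow_le`, by the spectral mapping property of the exponential and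
Gelfand's formula), and the variation of constants formula for integrable inputs
(`variation_of_constants`).
-/

/-! ### The matrix exponential and variation of constants -/

lemma act_add {p q : ℕ} (M N : Matrix (Fin p) (Fin q) ℝ) : act (M + N) = act M + act N := by
  ext1 x
  simp [act]

lemma act_sub {p q : ℕ} (M N : Matrix (Fin p) (Fin q) ℝ) : act (M - N) = act M - act N := by
  ext1 x
  simp [act]

lemma act_mul_apply {p q r : ℕ} (M : Matrix (Fin p) (Fin q) ℝ) (N : Matrix (Fin q) (Fin r) ℝ)
    (x : Vec r) : act (M * N) x = act M (act N x) := by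
  simp [act, Matrix.toLpLin_apply]

lemma exp_add_smul {𝔸 : Type*} [NormedRing 𝔸] [NormedAlgebra ℝ 𝔸] [CompleteSpace 𝔸] (a : 𝔸)
    (s t : ℝ) :
    NormedSpace.exp ((s + t) • a) = NormedSpace.exp (s • a) * NormedSpace.exp (t • a) := by
  let +nondep : NormedAlgebra ℚ 𝔸 := NormedAlgebra.restrictScalars ℚ ℝ 𝔸
  rw [add_smul, NormedSpace.exp_add_of_commute]
  exact ((Commute.refl a).smul_left s).smul_right t

section ExpFlow

variable {n : ℕ} (A : Matrix (Fin n) (Fin n) ℝ)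

lemma expFlow_zero : expFlow A 0 = 1 := by
  have h : (0 : ℝ) • act A = 0 := zero_smul ℝ (act A)
  rw [expFlow, h, NormedSpace.exp_zero]

lemma expFlow_add (s t : ℝ) : expFlow A (s + t) = expFlow A s * expFlow A t :=
  exp_add_smul (act A) s t

lemma expFlow_add_apply (s t : ℝ) (x : Vec n) :
    expFlow A (s + t) x = expFlow A s (expFlow A t x) := by
  rw [expFlow_add]; rfl

lemma expFlow_neg_apply_apply (t : ℝ) (x : Vec n) : expFlow A (-t) (expFlow A t x) = x := by
  rw [← expFlow_add_apply, neg_add_cancel, expFlow_zero]; rfl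

lemma hasDerivAt_expFlow (t : ℝ) : HasDerivAt (expFlow A) (expFlow A t * act A) t :=
  hasDerivAt_exp_smul_const (act A) t

lemma continuous_expFlow : Continuous (expFlow A) :=
  continuous_iff_continuousAt.2 fun t => (hasDerivAt_expFlow A t).continuousAt

lemma exists_norm_expFlow_le (R : ℝ) : ∃ c ≥ (1 : ℝ), ∀ t, |t| ≤ R → ‖expFlow A t‖ ≤ c := by
  obtain ⟨c, hc⟩ := (isCompact_Icc (a := -R) (b := R)).exists_bound_of_continuousOn
    (continuous_expFlow A).continuousOn
  exact ⟨max c 1, le_max_right _ _, fun t ht => (hc t (abs_le.1 ht)).trans (le_max_left _ _)⟩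

lemma exists_norm_expFlow_sub_le (R : ℝ) :
    ∃ c ≥ (1 : ℝ), ∀ s t, |s| ≤ R → |t| ≤ R → ‖expFlow A s - expFlow A t‖ ≤ c * |s - t| := by
  obtain ⟨c, hc1, hc⟩ := exists_norm_expFlow_le A R
  refine ⟨max 1 (c * ‖act A‖), le_max_left _ _, fun s t hs ht => ?_⟩
  have := (convex_Icc (-R) R).norm_image_sub_le_of_norm_hasDerivWithin_le (f := expFlow A)
    (f' := fun t => expFlow A t * act A) (C := max 1 (c * ‖act A‖)) (x := t) (y := s)
    (fun x _ => (hasDerivAt_expFlow A x).hasDerivWithinAt)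
    (fun x hx => (norm_mul_le _ _).trans ((mul_le_mul_of_nonneg_right (hc x (abs_le.2 hx))
      (norm_nonneg _)).trans (le_max_right _ _))) (abs_le.1 ht) (abs_le.1 hs)
  simpa [Real.norm_eq_abs] using this

end ExpFlow

lemma IntervalIntegrable.clm_apply_of_continuous {E F : Type*} [NormedAddCommGroup E]
    [NormedSpace ℝ E] [NormedAddCommGroup F] [NormedSpace ℝ F] {P : ℝ → E →L[ℝ] F}
    {f : ℝ → E} {a b : ℝ} (hf : IntervalIntegrable f volume a b) (hP : Continuous P) :
    IntervalIntegrable (fun s => P s (f s)) volume a b := by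
  obtain ⟨c, hc⟩ := (isCompact_uIcc (a := a) (b := b)).exists_bound_of_continuousOn
    hP.continuousOn
  refine (hf.norm.const_mul c).mono_fun ?_ ?_
  · exact (ContinuousLinearMap.id ℝ (E →L[ℝ] F)).aestronglyMeasurable_comp₂
      hP.aestronglyMeasurable hf.def'.aestronglyMeasurable
  · filter_upwards [ae_restrict_mem measurableSet_uIoc] with s hs
    have h1 := hc s (uIoc_subset_uIcc hs)
    rw [norm_mul, norm_norm, Real.norm_eq_abs]
    exact ((P s).le_opNorm _).trans
      (mul_le_mul_of_nonneg_right (h1.trans (le_abs_self c)) (norm_nonneg _))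

/-- Fubini on the triangle `a < r ≤ s ≤ t`. -/
lemma integral_clm_apply_primitive {E F : Type*} [NormedAddCommGroup E] [NormedSpace ℝ E]
    [CompleteSpace E] [NormedAddCommGroup F] [NormedSpace ℝ F] [CompleteSpace F]
    {P : ℝ → E →L[ℝ] F} {f : ℝ → E}
    {a t : ℝ} (hat : a ≤ t) (hP : Continuous P) (hf : IntervalIntegrable f volume a t) :
    ∫ s in a..t, P s (∫ r in a..s, f r) = ∫ r in a..t, (∫ s in r..t, P s) (f r) := by
  have hf' : IntegrableOn f (Ioc a t) := (intervalIntegrable_iff_integrableOn_Ioc_of_le hat).1 hf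
  have hP' : IntegrableOn P (Ioc a t) :=
    (intervalIntegrable_iff_integrableOn_Ioc_of_le hat).1 (hP.intervalIntegrable _ _)
  have hS : MeasurableSet {z : ℝ × ℝ | z.2 ≤ z.1} := measurableSet_le measurable_snd measurable_fst
  have hint : Integrable (fun z : ℝ × ℝ => {z : ℝ × ℝ | z.2 ≤ z.1}.indicator
      (fun z => P z.1 (f z.2)) z)
      ((volume.restrict (Ioc a t)).prod (volume.restrict (Ioc a t))) := by
    refine Integrable.indicator ?_ hS
    exact Integrable.op_fst_snd (op := fun (T : E →L[ℝ] F) x => T x)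
      isBoundedBilinearMap_apply.continuous
      ⟨1, fun T x => by simpa using T.le_opNorm x⟩ hP' hf'
  have hswap := integral_integral_swap (μ := volume.restrict (Ioc a t))
    (ν := volume.restrict (Ioc a t))
    (f := fun s r => {z : ℝ × ℝ | z.2 ≤ z.1}.indicator (fun z => P z.1 (f z.2)) (s, r)) hint
  rw [intervalIntegral.integral_of_le hat, intervalIntegral.integral_of_le hat]
  have h1 : ∀ s ∈ Ioc a t, P s (∫ r in a..s, f r) =
      ∫ r in Ioc a t, {z : ℝ × ℝ | z.2 ≤ z.1}.indicator (fun z => P z.1 (f z.2)) (s, r) := by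
    intro s hs
    have : (fun r => {z : ℝ × ℝ | z.2 ≤ z.1}.indicator (fun z => P z.1 (f z.2)) (s, r))
        = (Iic s).indicator (fun r => P s (f r)) := by
      ext r; simp [indicator]
    rw [this, setIntegral_indicator measurableSet_Iic, intervalIntegral.integral_of_le hs.1.le]
    have h2 : Ioc a t ∩ Iic s = Ioc a s := by
      ext r; simp only [mem_inter_iff, mem_Ioc, mem_Iic]
      constructor
      · rintro ⟨⟨h1, h2⟩, h3⟩; exact ⟨h1, h3⟩
      · rintro ⟨h1, h2⟩; exact ⟨⟨h1, h2.trans hs.2⟩, h2⟩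
    rw [h2, ContinuousLinearMap.integral_comp_comm]
    exact hf'.mono_set (Ioc_subset_Ioc_right hs.2)
  have h2 : ∀ r ∈ Ioc a t, (∫ s in r..t, P s) (f r) =
      ∫ s in Ioc a t, {z : ℝ × ℝ | z.2 ≤ z.1}.indicator (fun z => P z.1 (f z.2)) (s, r) := by
    intro r hr
    have : (fun s => {z : ℝ × ℝ | z.2 ≤ z.1}.indicator (fun z => P z.1 (f z.2)) (s, r))
        = (Ici r).indicator (fun s => P s (f r)) := by
      ext s; simp [indicator]
    rw [this, setIntegral_indicator measurableSet_Ici]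
    have h2 : Ioc a t ∩ Ici r = Icc r t := by
      ext s; simp only [mem_inter_iff, mem_Ioc, mem_Ici, mem_Icc]
      constructor
      · rintro ⟨⟨h1, h2⟩, h3⟩; exact ⟨h3, h2⟩
      · rintro ⟨h1, h2⟩; exact ⟨⟨hr.1.trans_le h1, h2⟩, h1⟩
    rw [h2, integral_Icc_eq_integral_Ioc, ← intervalIntegral.integral_of_le hr.2,
      ContinuousLinearMap.intervalIntegral_apply (hP.intervalIntegrable _ _)]
  rw [setIntegral_congr_fun measurableSet_Ioc h1, setIntegral_congr_fun measurableSet_Ioc h2,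
    hswap]

/-- Variation of constants for `Z' = A Z + f` in integrated form, with a merely integrable `f`.
Subtracting the primitive of `f` from `Z` leaves a `C¹` function, and Fubini on a triangle
replaces integration by parts. -/
lemma variation_of_constants {n : ℕ} (A : Matrix (Fin n) (Fin n) ℝ) {f Z : ℝ → Vec n} {a t : ℝ}
    (hat : a ≤ t) (hf : IntervalIntegrable f volume a t) (hZ : ContinuousOn Z (Icc a t))
    (h : ∀ s ∈ Icc a t, Z s = Z a + ∫ τ in a..s, (act A (Z τ) + f τ)) :
    Z t = expFlow A (t - a) (Z a) + ∫ τ in a..t, expFlow A (t - τ) (f τ) := by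
  set P : ℝ → Vec n →L[ℝ] Vec n := fun s => expFlow A (t - s) * act A with hPdef
  have hP : Continuous P :=
    ((continuous_expFlow A).comp (continuous_const.sub continuous_id)).mul continuous_const
  have hAZ : ContinuousOn (fun τ => act A (Z τ)) (Icc a t) :=
    (act A).continuous.comp_continuousOn hZ
  have hAZi : IntervalIntegrable (fun τ => act A (Z τ)) volume a t :=
    (hAZ.mono (by rw [uIcc_of_le hat])).intervalIntegrable
  have hsub : ∀ s ∈ Icc a t, uIcc a s ⊆ uIcc a t := fun s hs => by
    rw [uIcc_of_le hs.1, uIcc_of_le hat]; exact Icc_subset_Icc_right hs.2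
  have hg : ContinuousOn (fun s => ∫ r in a..s, f r) (Icc a t) := by
    have := intervalIntegral.continuousOn_primitive_interval' hf left_mem_uIcc
    rwa [uIcc_of_le hat] at this
  have hY : ∀ s ∈ Icc a t, Z s = (Z a + ∫ τ in a..s, act A (Z τ)) + ∫ r in a..s, f r := by
    intro s hs
    rw [add_assoc, ← intervalIntegral.integral_add (hAZi.mono_set (hsub s hs))
      (hf.mono_set (hsub s hs))]
    exact h s hs
  set Y : ℝ → Vec n := fun s => Z a + ∫ τ in a..s, act A (Z τ) with hYdef
  have hYc : ContinuousOn Y (Icc a t) := by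
    have := intervalIntegral.continuousOn_primitive_interval' hAZi left_mem_uIcc
    rw [uIcc_of_le hat] at this
    exact continuousOn_const.add this
  have hYd : ∀ s ∈ Ioo a t, HasDerivAt Y (act A (Z s)) s := by
    intro s hs
    refine HasDerivAt.const_add _ ?_
    refine intervalIntegral.integral_hasDerivAt_right
      (hAZi.mono_set (hsub s (Ioo_subset_Icc_self hs))) ?_
      (hAZ.continuousAt (Icc_mem_nhds hs.1 hs.2))
    exact (hAZ.mono Ioo_subset_Icc_self).stronglyMeasurableAtFilter isOpen_Ioo s hs
  have hEd : ∀ s, HasDerivAt (fun s => expFlow A (t - s)) (-(P s)) s := by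
    intro s
    have := (hasDerivAt_expFlow A (t - s)).scomp s ((hasDerivAt_id s).const_sub t)
    simpa [hPdef] using! this
  have hftc : ∫ s in a..t, P s (∫ r in a..s, f r)
      = expFlow A (t - t) (Y t) - expFlow A (t - a) (Y a) := by
    refine intervalIntegral.integral_eq_sub_of_hasDerivAt_of_le hat
      (f := fun s => expFlow A (t - s) (Y s)) ?_ ?_ ?_
    · exact (((continuous_expFlow A).comp
        (continuous_const.sub continuous_id)).continuousOn).clm_apply hYc
    · intro s hs
      have h1 := (hEd s).clm_apply (hYd s hs)
      convert! h1 using 1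
      have h2 : (-P s) (Y s) = -(P s (Y s)) := rfl
      have h3 : Z s = Y s + ∫ r in a..s, f r := hY s (Ioo_subset_Icc_self hs)
      rw [h3, map_add (act A), map_add (expFlow A (t - s)), h2]
      exact (neg_add_cancel_left _ _).symm
    · refine ContinuousOn.intervalIntegrable ?_
      rw [uIcc_of_le hat]
      exact hP.continuousOn.clm_apply hg
  have hPint : ∀ r, ∫ s in r..t, P s = expFlow A (t - r) - 1 := by
    intro r
    have := intervalIntegral.integral_eq_sub_of_hasDerivAt (a := r) (b := t)
      (f := fun s => -expFlow A (t - s)) (f' := P)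
      (fun s _ => by simpa using! (hEd s).neg) (hP.intervalIntegrable _ _)
    rw [this]; simp only [sub_self, expFlow_zero]; abel
  rw [integral_clm_apply_primitive hat hP hf] at hftc
  have hfe : IntervalIntegrable (fun τ => expFlow A (t - τ) (f τ)) volume a t :=
    hf.clm_apply_of_continuous ((continuous_expFlow A).comp (continuous_const.sub continuous_id))
  simp only [hPint, sub_apply] at hftc
  have h3 : ∫ r in a..t, (expFlow A (t - r) (f r) - (1 : Vec n →L[ℝ] Vec n) (f r))
      = (∫ r in a..t, expFlow A (t - r) (f r)) - ∫ r in a..t, f r :=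
    intervalIntegral.integral_sub hfe hf
  rw [h3, sub_self, expFlow_zero] at hftc
  have hYa : Y a = Z a := by simp [hYdef]
  rw [hYa] at hftc
  have h4 : Z t = Y t + ∫ r in a..t, f r := hY t (right_mem_Icc.2 hat)
  have : Y t = (1 : Vec n →L[ℝ] Vec n) (Y t) := rfl
  rw [eq_sub_iff_add_eq] at hftc
  rw [h4, this, ← hftc]
  abel

/-! ### Exponential decay of Hurwitz matrices -/

lemma ContinuousLinearMap.exp_apply_of_apply_eq_smul {E : Type*} [NormedAddCommGroup E]
    [NormedSpace ℂ E] [CompleteSpace E] {T : E →L[ℂ] E} {μ : ℂ} {w : E} (h : T w = μ • w) :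
    NormedSpace.exp T w = Complex.exp μ • w := by
  have hpow : ∀ k : ℕ, (T ^ k) w = μ ^ k • w := by
    intro k
    induction k with
    | zero => simp
    | succ k ih =>
      have : (T ^ (k + 1)) w = (T ^ k) (T w) := by rw [pow_succ]; rfl
      rw [this, h, map_smul, ih, smul_smul, pow_succ, mul_comm]
  have h1 := (NormedSpace.exp_series_hasSum_exp' (𝕂 := ℂ) T).mapL
    (ContinuousLinearMap.apply ℂ E w)
  have h2 := (NormedSpace.exp_series_hasSum_exp' (𝕂 := ℂ) μ).smul_const w
  rw [← Complex.exp_eq_exp_ℂ] at h2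
  refine h1.unique ?_
  convert! h2 using 2 with k
  simp [hpow, smul_smul]

/-- Spectral mapping for the exponential in finite dimensions: an eigenspace of `exp T` is
invariant under `T`, hence contains an eigenvector of `T`. -/
lemma ContinuousLinearMap.exists_mem_spectrum_exp_eq {E : Type*} [NormedAddCommGroup E]
    [NormedSpace ℂ E] [FiniteDimensional ℂ E] [CompleteSpace E] {T : E →L[ℂ] E} {z : ℂ}
    (hz : z ∈ spectrum ℂ (NormedSpace.exp T)) : ∃ μ ∈ spectrum ℂ T, z = Complex.exp μ := by
  have hspec : ∀ S : E →L[ℂ] E, spectrum ℂ S = spectrum ℂ (S : Module.End ℂ E) := fun S =>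
    (AlgEquiv.spectrum_eq (Module.End.toContinuousLinearMap E).symm S).symm
  rw [hspec, ← Module.End.hasEigenvalue_iff_mem_spectrum] at hz
  set S : Module.End ℂ E := ((NormedSpace.exp T : E →L[ℂ] E) : E →ₗ[ℂ] E) with hS
  have hcomm : Commute S (T : Module.End ℂ E) := by
    have : Commute (NormedSpace.exp T) T := (Commute.refl T).exp_left
    ext x
    exact congrArg (fun R : E →L[ℂ] E => R x) this.eq
  have hinv := Module.End.mapsTo_genEigenspace_of_comm hcomm z 1
  have : Nontrivial (S.genEigenspace z 1) := by
    rw [Submodule.nontrivial_iff_ne_bot]; exact hz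
  obtain ⟨μ, hμ⟩ := Module.End.exists_eigenvalue ((T : Module.End ℂ E).restrict hinv)
  obtain ⟨w, hw⟩ := hμ.exists_hasEigenvector
  have hw1 : T w = μ • (w : E) := congrArg Subtype.val hw.apply_eq_smul
  have hw0 : (w : E) ≠ 0 := by simpa using hw.2
  refine ⟨μ, ?_, ?_⟩
  · rw [hspec, ← Module.End.hasEigenvalue_iff_mem_spectrum]
    exact Module.End.hasEigenvalue_of_hasEigenvector ⟨Module.End.mem_eigenspace_iff.2 hw1, hw0⟩
  · have h1 : S w = z • (w : E) := Module.End.mem_eigenspace_iff.1 w.2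
    have h2 : S w = Complex.exp μ • (w : E) := exp_apply_of_apply_eq_smul hw1
    exact smul_left_injective ℂ hw0 (h1.symm.trans h2)

lemma exists_norm_pow_lt_one {𝔸 : Type*} [NormedRing 𝔸] [NormedAlgebra ℂ 𝔸] [CompleteSpace 𝔸]
    [Nontrivial 𝔸] {a : 𝔸} (h : ∀ z ∈ spectrum ℂ a, ‖z‖ < 1) :
    ∃ N : ℕ, 0 < N ∧ ‖a ^ N‖ < 1 := by
  have h1 : spectralRadius ℂ a < (1 : NNReal) :=
    spectrum.spectralRadius_lt_of_forall_lt a fun z hz => by exact_mod_cast h z hz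
  have h2 := (spectrum.pow_nnnorm_pow_one_div_tendsto_nhds_spectralRadius a).eventually
    (gt_mem_nhds h1)
  obtain ⟨N, hN, hN0⟩ := (h2.and (eventually_gt_atTop 0)).exists
  refine ⟨N, hN0, ?_⟩
  by_contra hcon
  refine not_le.2 hN ?_
  have h3 : (1 : ENNReal) ≤ ‖a ^ N‖₊ := by
    exact_mod_cast (not_lt.1 hcon : (1 : ℝ) ≤ ‖a ^ N‖)
  simpa using ENNReal.one_le_rpow h3 (by positivity : (0 : ℝ) < 1 / N)

/-- The complexification of operators on `ℝⁿ`, as a homomorphism of real algebras: it reads the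
matrix of the operator as a complex matrix. -/
noncomputable def complexification (n : ℕ) :
    (Vec n →L[ℝ] Vec n) →ₐ[ℝ] (EuclideanSpace ℂ (Fin n) →L[ℂ] EuclideanSpace ℂ (Fin n)) :=
  (((Matrix.toEuclideanCLM (n := Fin n) (𝕜 := ℂ)).toAlgEquiv.restrictScalars ℝ).toAlgHom.comp
    ((Algebra.ofId ℝ ℂ).mapMatrix)).comp
    (Matrix.toEuclideanCLM (n := Fin n) (𝕜 := ℝ)).toAlgEquiv.symm.toAlgHom

lemma complexification_act {n : ℕ} (A : Matrix (Fin n) (Fin n) ℝ) :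
    complexification n (act A) =
      Matrix.toEuclideanCLM (n := Fin n) (𝕜 := ℂ) (A.map (algebraMap ℝ ℂ)) := by
  have : act A = Matrix.toEuclideanCLM (n := Fin n) (𝕜 := ℝ) A := rfl
  rw [this]
  simp [complexification]
  rfl

lemma complexification_injective (n : ℕ) : Function.Injective (complexification n) := by
  refine ((Matrix.toEuclideanCLM (n := Fin n) (𝕜 := ℂ)).injective.comp ?_).comp
    (Matrix.toEuclideanCLM (n := Fin n) (𝕜 := ℝ)).symm.injective
  exact Matrix.map_injective (algebraMap ℝ ℂ).injective

/-- By spectral mapping `e^{A}` has spectral radius less than one, so its powers tend to zero. They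
are computed in the complexification, which is bounded below because it is injective and linear on
a finite-dimensional space. -/
lemma exists_norm_expFlow_natCast_le {n : ℕ} {A : Matrix (Fin n) (Fin n) ℝ} (hA : IsHurwitz A) :
    ∃ N : ℕ, 0 < N ∧ ‖expFlow A N‖ ≤ 1 / 2 := by
  rcases Nat.eq_zero_or_pos n with rfl | hn
  · refine ⟨1, one_pos, ?_⟩
    have : expFlow A (1 : ℕ) = 0 := by ext x i; exact i.elim0
    rw [this, norm_zero]; norm_num
  have : Nonempty (Fin n) := ⟨⟨0, hn⟩⟩
  set T := complexification n (act A) with hT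
  have hcont : Continuous (complexification n) :=
    (complexification n).toLinearMap.continuous_of_finiteDimensional
  have hspec : ∀ z ∈ spectrum ℂ (NormedSpace.exp T), ‖z‖ < 1 := by
    intro z hz
    obtain ⟨μ, hμ, rfl⟩ := ContinuousLinearMap.exists_mem_spectrum_exp_eq hz
    rw [hT, complexification_act, AlgEquiv.spectrum_eq] at hμ
    rw [Complex.norm_exp]
    simpa using hA μ hμ
  obtain ⟨N, hN0, hN⟩ := exists_norm_pow_lt_one hspec
  have hexp : ∀ k : ℕ, complexification n (expFlow A ((N * k : ℕ) : ℝ)) =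
      (NormedSpace.exp T ^ N) ^ k := by
    intro k
    let +nondep : NormedAlgebra ℚ (Vec n →L[ℝ] Vec n) := NormedAlgebra.restrictScalars ℚ ℝ _
    let +nondep : NormedAlgebra ℚ (EuclideanSpace ℂ (Fin n) →L[ℂ] EuclideanSpace ℂ (Fin n)) :=
      NormedAlgebra.restrictScalars ℚ ℂ _
    rw [← pow_mul, ← NormedSpace.exp_nsmul, hT, ← map_nsmul, ← NormedSpace.map_exp _ hcont]
    refine congrArg (fun S => complexification n (NormedSpace.exp S)) ?_
    exact Nat.cast_smul_eq_nsmul ℝ (N * k) (act A)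
  obtain ⟨κ, -, hκ⟩ := (complexification n).toLinearMap.exists_antilipschitzWith
    (LinearMap.ker_eq_bot.2 (complexification_injective n))
  have hlim : Tendsto (fun k : ℕ => κ * ‖(NormedSpace.exp T ^ N) ^ k‖) atTop (𝓝 (κ * 0)) :=
    Tendsto.const_mul _ (by simpa using (tendsto_pow_atTop_nhds_zero_of_norm_lt_one hN).norm)
  rw [mul_zero] at hlim
  obtain ⟨k, hk, hk0⟩ := ((hlim.eventually (gt_mem_nhds (by norm_num : (0 : ℝ) < 1 / 2))).and
    (eventually_gt_atTop 0)).exists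
  refine ⟨N * k, Nat.mul_pos hN0 hk0, ?_⟩
  have h1 := hκ.le_mul_dist (expFlow A ((N * k : ℕ) : ℝ)) 0
  rw [map_zero, dist_zero_right, dist_zero_right] at h1
  have h2 : (complexification n).toLinearMap (expFlow A ((N * k : ℕ) : ℝ)) =
    (NormedSpace.exp T ^ N) ^ k := hexp k
  rw [h2] at h1
  exact h1.trans hk.le

/-- If `M` is Hurwitz, then `‖e^{Mt}‖ ≤ k e^{-rt}` for `t ≥ 0`. -/
lemma IsHurwitz.exists_norm_expFlow_le {n : ℕ} {A : Matrix (Fin n) (Fin n) ℝ} (hA : IsHurwitz A) :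
    ∃ k ≥ (1 : ℝ), ∃ r > (0 : ℝ), ∀ t, 0 ≤ t → ‖expFlow A t‖ ≤ k * Real.exp (-r * t) := by
  obtain ⟨N, hN0, hN⟩ := exists_norm_expFlow_natCast_le hA
  have hNpos : (0 : ℝ) < N := by exact_mod_cast hN0
  obtain ⟨c, hc1, hc⟩ := _root_.exists_norm_expFlow_le A N
  set r : ℝ := Real.log 2 / N with hr
  have hstep : ∀ k : ℕ, ∀ s : ℝ, 0 ≤ s → s ≤ N → ‖expFlow A (s + k * N)‖ ≤ c * (1 / 2) ^ k := by
    intro k s hs0 hs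
    induction k with
    | zero => simpa using hc s (abs_le.2 ⟨by linarith, hs⟩)
    | succ k ih =>
      have : s + ((k + 1 : ℕ) : ℝ) * N = (s + k * N) + N := by push_cast; ring
      rw [this, expFlow_add, pow_succ, ← mul_assoc]
      exact (norm_mul_le _ _).trans (mul_le_mul ih hN (norm_nonneg _) (by positivity))
  refine ⟨c * 2, by linarith, r, by positivity, fun t ht => ?_⟩
  set k := ⌊t / N⌋₊ with hk
  have h1 : (k : ℝ) * N ≤ t := (le_div_iff₀ hNpos).1 (Nat.floor_le (by positivity))
  have h2 : t < (k + 1) * N := (div_lt_iff₀ hNpos).1 (Nat.lt_floor_add_one _)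
  have h3 := hstep k (t - k * N) (by linarith) (by linarith)
  rw [sub_add_cancel] at h3
  refine h3.trans ?_
  rw [mul_assoc]
  refine mul_le_mul_of_nonneg_left ?_ (by linarith)
  have h4 : ((1 : ℝ) / 2) ^ k = 2 * Real.exp (-Real.log 2 * (k + 1)) := by
    have : -Real.log 2 * (k + 1) = k * -Real.log 2 + -Real.log 2 := by ring
    rw [this, Real.exp_add, Real.exp_nat_mul, Real.exp_neg, Real.exp_log two_pos]
    ring
  rw [h4]
  refine mul_le_mul_of_nonneg_left (Real.exp_le_exp.2 ?_) two_pos.le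
  have h5 : t / N ≤ k + 1 := (div_le_iff₀ hNpos).2 h2.le
  have h6 : -r * t = -Real.log 2 * (t / N) := by rw [hr]; ring
  rw [h6]
  have := Real.log_pos one_lt_two
  nlinarith

/-! ### Delayed times and their inverses -/

section Delay

variable {D : ℝ → ℝ}

lemma DelayInvertible.hasDerivAt (h : DelayInvertible D) {t : ℝ} (ht : 0 < t) :
    HasDerivAt (delayedTime D) (deriv (delayedTime D) t) t :=
  ((h.contDiffOn.differentiableOn one_ne_zero).differentiableAt (Ici_mem_nhds ht)).hasDerivAt

lemma DelayInvertible.strictMonoOn (h : DelayInvertible D) :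
    StrictMonoOn (delayedTime D) (Ici 0) := by
  obtain ⟨c, hc0, hc⟩ := h.lower
  refine strictMonoOn_of_deriv_pos (convex_Ici 0) h.contDiffOn.continuousOn fun t ht => ?_
  rw [interior_Ici] at ht
  exact hc0.trans_le (hc t ht)

lemma DelayInvertible.surjOn (h : DelayInvertible D) :
    SurjOn (delayedTime D) (Ici 0) (Ici (delayedTime D 0)) := by
  obtain ⟨c, hc0, hc⟩ := h.lower
  intro y hy
  have hT : 0 ≤ (y - delayedTime D 0) / c := div_nonneg (sub_nonneg.2 hy) hc0.le
  have h1 := (convex_Ici (0 : ℝ)).mul_sub_le_image_sub_of_le_deriv h.contDiffOn.continuousOn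
    ((h.contDiffOn.differentiableOn one_ne_zero).mono interior_subset)
    (fun x hx => hc x (by rwa [interior_Ici] at hx)) 0 self_mem_Ici _ hT hT
  rw [sub_zero, mul_div_cancel₀ _ hc0.ne'] at h1
  obtain ⟨x, hx, hxy⟩ := intermediate_value_Icc hT
    (h.contDiffOn.continuousOn.mono Icc_subset_Ici_self) ⟨hy, by linarith⟩
  exact ⟨x, hx.1, hxy⟩

lemma DelayInvertible.inv_nonneg (h : DelayInvertible D) {y : ℝ} (hy : delayedTime D 0 ≤ y) :
    0 ≤ delayedTimeInv D y :=
  Function.invFunOn_mem (h.surjOn hy)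

lemma DelayInvertible.delayedTime_inv (h : DelayInvertible D) {y : ℝ}
    (hy : delayedTime D 0 ≤ y) : delayedTime D (delayedTimeInv D y) = y :=
  Function.invFunOn_eq (h.surjOn hy)

lemma DelayInvertible.inv_delayedTime (h : DelayInvertible D) {s : ℝ} (hs : 0 ≤ s) :
    delayedTimeInv D (delayedTime D s) = s :=
  h.strictMonoOn.injOn.leftInvOn_invFunOn hs

/-- The lower bound of the delay extends to `t = 0` by continuity. -/
lemma DelayPositiveBounded.exists_pos_le (h : DelayPositiveBounded D) :
    ∃ c > 0, ∀ t, 0 ≤ t → c ≤ D t := by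
  obtain ⟨c, hc0, hc⟩ := h.lower
  refine ⟨c, hc0, fun t ht => ?_⟩
  have hD : ContinuousOn (fun t => t - delayedTime D t) (Ici 0) :=
    continuousOn_id.sub h.contDiffOn.continuousOn
  have h1 : closure (Ioi (0 : ℝ)) ⊆ Ici 0 := by rw [closure_Ioi]
  have := ContinuousWithinAt.closure_le (f := fun _ => c) (g := fun t => t - delayedTime D t)
    (s := Ioi 0) (x := t) (by rwa [closure_Ioi]) continuousWithinAt_const
    ((hD t ht).mono Ioi_subset_Ici_self) (fun y hy => hc y hy)
  simpa [delayedTime] using this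

lemma DelayPositiveBounded.delayedTime_lt (h : DelayPositiveBounded D) {t : ℝ} (ht : 0 ≤ t) :
    delayedTime D t < t := by
  obtain ⟨c, hc0, hc⟩ := h.exists_pos_le
  have := hc t ht
  unfold delayedTime
  linarith

/-- The delay is bounded on all of `[0, ∞)`, by compactness before `φ⁻¹(0)`. -/
lemma DelayPositiveBounded.exists_le (h : DelayPositiveBounded D) :
    ∃ c > 0, ∀ t, 0 ≤ t → D t ≤ c := by
  obtain ⟨c₁, hc₁⟩ := h.upper
  have hD : ContinuousOn (fun t => t - delayedTime D t) (Ici 0) :=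
    continuousOn_id.sub h.contDiffOn.continuousOn
  obtain ⟨c₂, hc₂⟩ :=
    (isCompact_Icc (a := 0) (b := delayedTimeInv D 0)).exists_bound_of_continuousOn (hD.mono Icc_subset_Ici_self)
  refine ⟨max 1 (max c₁ c₂), by positivity, fun t ht => ?_⟩
  have hDt : D t = t - delayedTime D t := by simp [delayedTime]
  rw [hDt]
  rcases le_total (delayedTimeInv D 0) t with h1 | h1
  · exact (hc₁ (mem_image_of_mem _ h1)).trans ((le_max_left _ _).trans (le_max_right _ _))
  · exact (le_abs_self _).trans ((hc₂ t ⟨ht, h1⟩).trans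
      ((le_max_right _ _).trans (le_max_right _ _)))

lemma DelayInvertible.inv_mono (h : DelayInvertible D) {x y : ℝ} (hx : delayedTime D 0 ≤ x)
    (hxy : x ≤ y) : delayedTimeInv D x ≤ delayedTimeInv D y := by
  rw [← h.strictMonoOn.le_iff_le (h.inv_nonneg hx) (h.inv_nonneg (hx.trans hxy)),
    h.delayedTime_inv hx, h.delayedTime_inv (hx.trans hxy)]
  exact hxy

lemma add_predictionHorizon (D : ℝ → ℝ) (t : ℝ) :
    t + predictionHorizon D t = delayedTimeInv D t := by
  simp [predictionHorizon]

lemma DelayInvertible.predictionHorizon_eq (h : DelayInvertible D) {t : ℝ}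
    (ht : delayedTime D 0 ≤ t) : predictionHorizon D t = D (delayedTimeInv D t) := by
  have := h.delayedTime_inv ht
  unfold delayedTime at this
  unfold predictionHorizon
  linarith

end Delay

/-! ### The observer error -/

section Observer

variable {n m p : ℕ} {A : Matrix (Fin n) (Fin n) ℝ} {B : Matrix (Fin n) (Fin m) ℝ}
  {C : Matrix (Fin p) (Fin n) ℝ} {L : Matrix (Fin n) (Fin p) ℝ} {D₁ D₂ : ℝ → ℝ}
  {Z : ℝ → Vec n} {U : ℝ → Vec m} {ξ : ℝ → Vec n}

lemma PlantObserver.intervalIntegrable_input (h : PlantObserver A B C L D₁ D₂ Z U ξ) {a t : ℝ}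
    (ha : delayedTime D₂ 0 ≤ a) (hat : a ≤ t) :
    IntervalIntegrable (fun τ => U (delayedTime D₁ τ)) volume a t := by
  refine (h.input_integrable t (ha.trans hat)).mono_set ?_
  rw [uIcc_of_le hat, uIcc_of_le (ha.trans hat)]
  exact Icc_subset_Icc_left ha

lemma PlantObserver.intervalIntegrable_act_input (h : PlantObserver A B C L D₁ D₂ Z U ξ)
    {a t : ℝ} (ha : delayedTime D₂ 0 ≤ a) (hat : a ≤ t) :
    IntervalIntegrable (fun τ => act B (U (delayedTime D₁ τ))) volume a t :=
  (h.intervalIntegrable_input ha hat).clm_apply_of_continuous (P := fun _ => act B)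
    continuous_const

lemma PlantObserver.integrand_intervalIntegrable (h : PlantObserver A B C L D₁ D₂ Z U ξ)
    {a t : ℝ} (ha : delayedTime D₂ 0 ≤ a) (hat : a ≤ t) :
    IntervalIntegrable (fun τ => act A (Z τ) + act B (U (delayedTime D₁ τ))) volume a t := by
  refine IntervalIntegrable.add (ContinuousOn.intervalIntegrable ?_)
    (h.intervalIntegrable_act_input ha hat)
  refine (act A).continuous.comp_continuousOn (h.state_continuous.mono ?_)
  rw [uIcc_of_le hat]
  exact fun s hs => ha.trans hs.1

lemma PlantObserver.state_integral_eq (h : PlantObserver A B C L D₁ D₂ Z U ξ) {a t : ℝ}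
    (ha : delayedTime D₂ 0 ≤ a) (hat : a ≤ t) :
    Z t = Z a + ∫ τ in a..t, (act A (Z τ) + act B (U (delayedTime D₁ τ))) := by
  rw [h.plant t (ha.trans hat), h.plant a ha, add_assoc,
    intervalIntegral.integral_add_adjacent_intervals
      (h.integrand_intervalIntegrable le_rfl ha) (h.integrand_intervalIntegrable ha hat)]

/-- If `e(t) = e(0) + ∫₀ᵗ φ' M e`, then `e(t) = e^{M(φ(t) - φ(0))} e(0)`. -/
lemma eq_expFlow_of_integral_eq {M : Matrix (Fin n) (Fin n) ℝ} {φ : ℝ → ℝ} {e : ℝ → Vec n}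
    (hφ : ContDiffOn ℝ 1 φ (Ici 0)) (he : ContinuousOn e (Ici 0))
    (h : ∀ t, 0 ≤ t → e t = e 0 + ∫ s in (0 : ℝ)..t, deriv φ s • act M (e s)) {t : ℝ}
    (ht : 0 ≤ t) : e t = expFlow M (φ t - φ 0) (e 0) := by
  have hq : ContinuousOn (derivWithin φ (Ici 0)) (Ici 0) :=
    hφ.continuousOn_derivWithin (uniqueDiffOn_Ici 0) le_rfl
  have hqd : ∀ s, 0 < s → derivWithin φ (Ici 0) s = deriv φ s := fun s hs =>
    derivWithin_of_mem_nhds (Ici_mem_nhds hs)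
  have hint : ContinuousOn (fun s => derivWithin φ (Ici 0) s • act M (e s)) (Ici 0) :=
    hq.smul ((act M).continuous.comp_continuousOn he)
  have hint' : ContinuousOn (fun s => deriv φ s • act M (e s)) (Ioi 0) :=
    (hint.mono Ioi_subset_Ici_self).congr fun s hs => by simp only [hqd s hs]
  have hii : ∀ s, 0 ≤ s → IntervalIntegrable (fun s => deriv φ s • act M (e s)) volume 0 s := by
    intro s hs
    have : IntervalIntegrable (fun s => derivWithin φ (Ici 0) s • act M (e s)) volume 0 s :=
      (hint.mono (by rw [uIcc_of_le hs]; exact Icc_subset_Ici_self)).intervalIntegrable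
    refine this.congr fun r hr => ?_
    rw [uIoc_of_le hs] at hr
    simp only [hqd r hr.1]
  have hed : ∀ s, 0 < s → HasDerivAt e (deriv φ s • act M (e s)) s := by
    intro s hs
    have h1 : HasDerivAt (fun t => e 0 + ∫ s in (0 : ℝ)..t, deriv φ s • act M (e s))
        (deriv φ s • act M (e s)) s :=
      (intervalIntegral.integral_hasDerivAt_right (hii s hs.le)
        (hint'.stronglyMeasurableAtFilter isOpen_Ioi s hs)
        (hint'.continuousAt (Ioi_mem_nhds hs))).const_add _
    refine h1.congr_of_eventuallyEq ?_
    filter_upwards [Ioi_mem_nhds hs] with r hr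
    exact h r (le_of_lt hr)
  have hφd : ∀ s, 0 < s → HasDerivAt φ (deriv φ s) s := fun s hs =>
    ((hφ.differentiableOn one_ne_zero).differentiableAt (Ici_mem_nhds hs)).hasDerivAt
  have hconst := intervalIntegral.integral_eq_sub_of_hasDerivAt_of_le ht
    (f := fun s => expFlow M (-φ s) (e s)) (f' := fun _ => 0)
    (((continuous_expFlow M).comp_continuousOn
      (hφ.continuousOn.mono Icc_subset_Ici_self).neg).clm_apply (he.mono Icc_subset_Ici_self))
    (fun s hs => ?_) intervalIntegrable_const
  · rw [intervalIntegral.integral_zero, eq_comm, sub_eq_zero] at hconst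
    rw [sub_eq_add_neg, expFlow_add_apply, ← hconst]
    have := expFlow_neg_apply_apply M (-φ t) (e t)
    rw [neg_neg] at this
    exact this.symm
  · have h0 : HasDerivAt (fun s => expFlow M (-φ s))
        (-deriv φ s • (expFlow M (-φ s) * act M)) s := by
      have := HasDerivAt.scomp (g₁ := expFlow M) (h := fun s => -φ s) s
        (hasDerivAt_expFlow M (-φ s)) (hφd s hs.1).fun_neg
      exact this
    have h1 := h0.clm_apply (hed s hs.1)
    have h2 : (-deriv φ s • (expFlow M (-φ s) * act M)) (e s) =
        -(deriv φ s • expFlow M (-φ s) (act M (e s))) :=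
      neg_smul (deriv φ s) (expFlow M (-φ s) (act M (e s)))
    rw [h2, map_smul, neg_add_cancel] at h1
    exact h1

/-- The plant seen through the measurement delay. -/
lemma PlantObserver.state_delayedTime (h : PlantObserver A B C L D₁ D₂ Z U ξ)
    (h₂' : DelayInvertible D₂) {t : ℝ} (ht : 0 ≤ t) :
    IntervalIntegrable (fun s => deriv (delayedTime D₂) s • (act A (Z (delayedTime D₂ s)) +
      act B (U (delayedTime D₁ (delayedTime D₂ s))))) volume 0 t ∧
    Z (delayedTime D₂ t) = Z (delayedTime D₂ 0) + ∫ s in (0 : ℝ)..t, deriv (delayedTime D₂) s •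
      (act A (Z (delayedTime D₂ s)) + act B (U (delayedTime D₁ (delayedTime D₂ s)))) := by
  obtain ⟨c, hc0, hc⟩ := h₂'.lower
  have hle : delayedTime D₂ 0 ≤ delayedTime D₂ t :=
    h₂'.strictMonoOn.monotoneOn self_mem_Ici ht ht
  have hcont : ContinuousOn (delayedTime D₂) (Icc 0 t) :=
    h₂'.contDiffOn.continuousOn.mono Icc_subset_Ici_self
  have hd : ∀ s ∈ Ioo 0 t, HasDerivAt (delayedTime D₂) (deriv (delayedTime D₂) s) s :=
    fun s hs => h₂'.hasDerivAt hs.1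
  have hd0 : ∀ s ∈ Ioo 0 t, 0 ≤ deriv (delayedTime D₂) s := fun s hs => hc0.le.trans (hc s hs.1)
  constructor
  · rw [intervalIntegrable_iff_integrableOn_Icc_of_le ht]
    refine (integrableOn_Icc_deriv_smul_iff_of_deriv_nonneg (g := fun τ => act A (Z τ) +
      act B (U (delayedTime D₁ τ))) hcont hd hd0 ht).2 ?_
    rw [← intervalIntegrable_iff_integrableOn_Icc_of_le hle]
    exact h.integrand_intervalIntegrable le_rfl hle
  · rw [h.plant _ hle, intervalIntegral.integral_of_le ht, ← integral_Icc_eq_integral_Ioc,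
      intervalIntegral.integral_of_le hle, ← integral_Icc_eq_integral_Ioc]
    exact congrArg _ (integral_Icc_deriv_smul_of_deriv_nonneg (g := fun τ => act A (Z τ) +
      act B (U (delayedTime D₁ τ))) hcont hd hd0 ht).symm

/-- The error `Z(φ₂(t)) - ξ(t)` obeys the homogeneous equation `e' = φ₂' (A - LC) e`. -/
lemma PlantObserver.observer_error_eq (h : PlantObserver A B C L D₁ D₂ Z U ξ)
    (h₂' : DelayInvertible D₂) {t : ℝ} (ht : 0 ≤ t) :
    Z (delayedTime D₂ t) - ξ t = expFlow (A - L * C) (delayedTime D₂ t - delayedTime D₂ 0)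
      (Z (delayedTime D₂ 0) - ξ 0) := by
  have hmaps : MapsTo (delayedTime D₂) (Ici 0) (Ici (delayedTime D₂ 0)) := fun s hs =>
    h₂'.strictMonoOn.monotoneOn self_mem_Ici hs hs
  have he : ContinuousOn (fun t => Z (delayedTime D₂ t) - ξ t) (Ici 0) :=
    (h.state_continuous.comp h₂'.contDiffOn.continuousOn hmaps).sub h.observer_continuous
  have hq : ContinuousOn (derivWithin (delayedTime D₂) (Ici 0)) (Ici 0) :=
    h₂'.contDiffOn.continuousOn_derivWithin (uniqueDiffOn_Ici 0) le_rfl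
  refine eq_expFlow_of_integral_eq (M := A - L * C)
    (e := fun t => Z (delayedTime D₂ t) - ξ t) h₂'.contDiffOn he (fun t ht => ?_) ht
  obtain ⟨hi, hZ⟩ := h.state_delayedTime h₂' ht
  have hei : IntervalIntegrable (fun s => deriv (delayedTime D₂) s •
      act (A - L * C) (Z (delayedTime D₂ s) - ξ s)) volume 0 t := by
    have : IntervalIntegrable (fun s => derivWithin (delayedTime D₂) (Ici 0) s •
        act (A - L * C) (Z (delayedTime D₂ s) - ξ s)) volume 0 t := by
      refine ContinuousOn.intervalIntegrable ?_
      rw [uIcc_of_le ht]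
      exact (hq.smul ((act (A - L * C)).continuous.comp_continuousOn he)).mono Icc_subset_Ici_self
    refine this.congr fun r hr => ?_
    rw [uIoc_of_le ht] at hr
    simp only [derivWithin_of_mem_nhds (Ici_mem_nhds hr.1)]
  have hsub := intervalIntegral.integral_sub hi hei
  have hcongr : ∀ s, deriv (delayedTime D₂) s • (act A (ξ s) +
      act B (U (delayedTime D₁ (delayedTime D₂ s))) +
        act L (measurement C D₂ Z s - act C (ξ s))) =
      deriv (delayedTime D₂) s • (act A (Z (delayedTime D₂ s)) +
        act B (U (delayedTime D₁ (delayedTime D₂ s)))) -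
      deriv (delayedTime D₂) s • act (A - L * C) (Z (delayedTime D₂ s) - ξ s) := by
    intro s
    rw [← smul_sub, act_sub, sub_apply, act_mul_apply, measurement, ← map_sub (act C),
      map_sub (act A)]
    congr 1
    abel
  change Z (delayedTime D₂ t) - ξ t = Z (delayedTime D₂ 0) - ξ 0 + _
  rw [h.observer t ht, intervalIntegral.integral_congr fun s _ => hcongr s, hsub, hZ]
  abel

/-- On any interval after `φ₂(0)` the plant obeys the variation of constants formula. -/
lemma PlantObserver.state_eq (h : PlantObserver A B C L D₁ D₂ Z U ξ) {a t : ℝ}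
    (ha : delayedTime D₂ 0 ≤ a) (hat : a ≤ t) :
    Z t = expFlow A (t - a) (Z a) +
      ∫ τ in a..t, expFlow A (t - τ) (act B (U (delayedTime D₁ τ))) :=
  variation_of_constants A hat (h.intervalIntegrable_act_input ha hat)
    (h.state_continuous.mono fun _ hs => ha.trans hs.1)
    fun _ hs => h.state_integral_eq ha hs.1

/-- The reconstruction solves the plant equation on `[φ₂(t), t]` from `ξ(t)`, so its error is the
observer error transported by the flow of `A`. -/
lemma PlantObserver.state_sub_reconstruction (h : PlantObserver A B C L D₁ D₂ Z U ξ)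
    (h₂ : DelayPositiveBounded D₂) (h₂' : DelayInvertible D₂) {t : ℝ} (ht : 0 ≤ t) :
    Z t - reconstruction A B D₁ D₂ U ξ t =
      expFlow A (t - delayedTime D₂ t) (Z (delayedTime D₂ t) - ξ t) := by
  have h1 := h.state_eq (h₂'.strictMonoOn.monotoneOn self_mem_Ici ht ht)
    (h₂.delayedTime_lt ht).le
  rw [reconstruction, h1, map_sub]
  abel

end Observer

/-! ### The error of the approximate predictor -/

section HorizonError

variable {n : ℕ} {A : Matrix (Fin n) (Fin n) ℝ} {g : ℝ → Vec n} {t ψ η ε H W c₀ c₁ : ℝ}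

/-- Effect of replacing the horizon `ψ` by `η` in the predictor integral, when input values beyond
the true horizon are cut off. -/
lemma norm_cutoff_integral_sub_le {p : ℝ → Prop} [DecidablePred p]
    (hg : IntervalIntegrable g volume t (t + ψ)) (hW : ∀ s ∈ Icc t (t + ψ), ‖g s‖ ≤ W)
    (hp : ∀ s, t < s → (p s ↔ s ≤ t + ψ)) (hψ : 0 ≤ ψ) (hψH : ψ ≤ H) (hη : 0 ≤ η)
    (hηψ : |ψ - η| ≤ ε) (hε : ε ≤ 1)
    (hc₀ : ∀ s, |s| ≤ H + 1 → ‖expFlow A s‖ ≤ c₀)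
    (hc₁ : ∀ s r, |s| ≤ H + 1 → |r| ≤ H + 1 → ‖expFlow A s - expFlow A r‖ ≤ c₁ * |s - r|) :
    ‖(∫ s in t..(t + η), if p s then expFlow A (t + η - s) (g s) else 0) -
      ∫ s in t..(t + ψ), expFlow A (t + ψ - s) (g s)‖ ≤ (H * c₁ + c₀) * ε * W := by
  obtain ⟨hlo, hhi⟩ := abs_le.1 hηψ
  -- both cases `η ≤ ψ` and `ψ ≤ η` reduce to an integral up to `t + min ψ η`
  have hcut : (∫ s in t..(t + η), if p s then expFlow A (t + η - s) (g s) else 0) =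
      ∫ s in t..(t + min ψ η), expFlow A (t + η - s) (g s) := by
    rw [intervalIntegral.integral_of_le (by linarith),
      intervalIntegral.integral_of_le (by linarith [le_min hψ hη])]
    have h1 : ∫ s in Ioc t (t + η), (if p s then expFlow A (t + η - s) (g s) else 0) =
        ∫ s in Ioc t (t + η), (Iic (t + ψ)).indicator
          (fun s => expFlow A (t + η - s) (g s)) s := by
      refine setIntegral_congr_fun measurableSet_Ioc fun s hs => ?_
      simp only [indicator, mem_Iic, hp s hs.1]
    have h2 : Ioc t (t + η) ∩ Iic (t + ψ) = Ioc t (t + min ψ η) := by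
      ext s
      simp only [mem_inter_iff, mem_Ioc, mem_Iic, ← min_add_add_left, le_min_iff]
      tauto
    rw [h1, setIntegral_indicator measurableSet_Iic, h2]
  set q := min ψ η with hq
  have hq0 : 0 ≤ q := le_min hψ hη
  have hqψ : q ≤ ψ := min_le_left _ _
  have hqη : q ≤ η := min_le_right _ _
  have hψq : ψ - q ≤ ε := by
    rcases min_choice ψ η with h | h <;> rw [hq, h] <;> linarith [abs_nonneg (ψ - η)]
  have hg1 : IntervalIntegrable g volume t (t + q) := hg.mono_set (by
    rw [uIcc_of_le (by linarith), uIcc_of_le (by linarith)]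
    exact Icc_subset_Icc_right (by linarith))
  have hg2 : IntervalIntegrable g volume (t + q) (t + ψ) := hg.mono_set (by
    rw [uIcc_of_le (by linarith), uIcc_of_le (by linarith)]
    exact Icc_subset_Icc_left (by linarith))
  have hE : ∀ b : ℝ, Continuous fun s => expFlow A (b - s) := fun b =>
    (continuous_expFlow A).comp (continuous_const.sub continuous_id)
  have hsplit := intervalIntegral.integral_add_adjacent_intervals
    (hg1.clm_apply_of_continuous (hE (t + ψ))) (hg2.clm_apply_of_continuous (hE (t + ψ)))
  rw [hcut, ← hsplit, ← sub_sub, ← intervalIntegral.integral_sub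
    (hg1.clm_apply_of_continuous (hE _)) (hg1.clm_apply_of_continuous (hE _))]
  have hW0 : 0 ≤ W := (norm_nonneg _).trans (hW t ⟨le_rfl, by linarith⟩)
  have hε0 : 0 ≤ ε := (abs_nonneg _).trans hηψ
  have hc₀0 : 0 ≤ c₀ := (norm_nonneg _).trans (hc₀ 0 (by rw [abs_zero]; linarith))
  have hc₁0 : 0 ≤ c₁ := by
    have := (norm_nonneg _).trans (hc₁ 1 0 (by rw [abs_one]; linarith) (by rw [abs_zero]; linarith))
    simpa using this
  have hb1 : ‖∫ s in t..(t + q), (expFlow A (t + η - s) (g s) - expFlow A (t + ψ - s) (g s))‖ ≤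
      c₁ * ε * W * |t + q - t| := by
    refine intervalIntegral.norm_integral_le_of_norm_le_const fun s hs => ?_
    rw [uIoc_of_le (by linarith)] at hs
    rw [← sub_apply]
    refine (ContinuousLinearMap.le_opNorm _ _).trans (mul_le_mul ?_
      (hW s ⟨hs.1.le, by linarith [hs.2]⟩) (norm_nonneg _) (by positivity))
    refine (hc₁ _ _ (abs_le.2 ⟨?_, ?_⟩) (abs_le.2 ⟨?_, ?_⟩)).trans
      (mul_le_mul_of_nonneg_left ?_ hc₁0) <;> try linarith [hs.1, hs.2]
    rw [show t + η - s - (t + ψ - s) = -(ψ - η) by ring, abs_neg]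
    exact hηψ
  have hb2 : ‖∫ s in (t + q)..(t + ψ), expFlow A (t + ψ - s) (g s)‖ ≤
      c₀ * W * |t + ψ - (t + q)| := by
    refine intervalIntegral.norm_integral_le_of_norm_le_const fun s hs => ?_
    rw [uIoc_of_le (by linarith)] at hs
    refine (ContinuousLinearMap.le_opNorm _ _).trans (mul_le_mul (hc₀ _ (abs_le.2 ⟨?_, ?_⟩))
      (hW s ⟨by linarith [hs.1], hs.2⟩) (norm_nonneg _) hc₀0) <;> linarith [hs.1, hs.2]
  rw [abs_of_nonneg (by linarith)] at hb1 hb2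
  refine (norm_sub_le _ _).trans ((add_le_add hb1 hb2).trans ?_)
  have h1 : c₁ * ε * W * (t + q - t) ≤ c₁ * ε * W * H :=
    mul_le_mul_of_nonneg_left (by linarith) (by positivity)
  have h2 : c₀ * W * (t + ψ - (t + q)) ≤ c₀ * W * ε :=
    mul_le_mul_of_nonneg_left (by linarith) (by positivity)
  linarith

/-- Effect of replacing the horizon `ψ` by `η` in the distributed form of the predictor integral. -/
lemma norm_distributed_integral_sub_le
    (hg : IntervalIntegrable g volume t (t + ψ)) (hW : ∀ s ∈ Icc t (t + ψ), ‖g s‖ ≤ W)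
    (hψ : 0 < ψ) (hψH : ψ ≤ H) (hη : 0 ≤ η) (hηψ : |ψ - η| ≤ ε) (hε : ε ≤ 1)
    (hc₀ : ∀ s, |s| ≤ H + 1 → ‖expFlow A s‖ ≤ c₀)
    (hc₁ : ∀ s r, |s| ≤ H + 1 → |r| ≤ H + 1 → ‖expFlow A s - expFlow A r‖ ≤ c₁ * |s - r|) :
    ‖(∫ x in (0 : ℝ)..1, η • expFlow A ((1 - x) * η) (g (t + x * ψ))) -
      ∫ s in t..(t + ψ), expFlow A (t + ψ - s) (g s)‖ ≤ (H * c₁ + c₀) * ε * W := by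
  obtain ⟨hlo, hhi⟩ := abs_le.1 hηψ
  have hW0 : 0 ≤ W := (norm_nonneg _).trans (hW t ⟨le_rfl, by linarith⟩)
  have hε0 : 0 ≤ ε := (abs_nonneg _).trans hηψ
  have hc₀0 : 0 ≤ c₀ := (norm_nonneg _).trans (hc₀ 0 (by rw [abs_zero]; linarith))
  have hc₁0 : 0 ≤ c₁ := by
    have := (norm_nonneg _).trans (hc₁ 1 0 (by rw [abs_one]; linarith) (by rw [abs_zero]; linarith))
    simpa using this
  have hsubst : ∫ s in t..(t + ψ), expFlow A (t + ψ - s) (g s) =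
      ∫ x in (0 : ℝ)..1, ψ • expFlow A ((1 - x) * ψ) (g (t + x * ψ)) := by
    have h1 := intervalIntegral.smul_integral_comp_add_mul
      (fun s => expFlow A (t + ψ - s) (g s)) ψ t (a := 0) (b := 1)
    rw [mul_zero, mul_one, add_zero] at h1
    rw [← h1, ← intervalIntegral.integral_smul]
    refine intervalIntegral.integral_congr fun x _ => ?_
    rw [show t + ψ - (t + ψ * x) = (1 - x) * ψ by ring, mul_comm ψ x]
  have hgx : IntervalIntegrable (fun x => g (t + x * ψ)) volume 0 1 := by
    have h1 := (hg.comp_add_left t).comp_mul_right (c := ψ)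
    simpa [hψ.ne'] using h1
  have hE : ∀ b : ℝ, IntervalIntegrable
      (fun x => b • expFlow A ((1 - x) * b) (g (t + x * ψ))) volume 0 1 := fun b =>
    (hgx.clm_apply_of_continuous ((continuous_expFlow A).comp
      ((continuous_const.sub continuous_id).mul continuous_const))).smul b
  rw [hsubst, ← intervalIntegral.integral_sub (hE η) (hE ψ)]
  have hb : ‖∫ x in (0 : ℝ)..1, (η • expFlow A ((1 - x) * η) (g (t + x * ψ)) -
      ψ • expFlow A ((1 - x) * ψ) (g (t + x * ψ)))‖ ≤ (H * c₁ + c₀) * ε * W * |(1 : ℝ) - 0| := by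
    refine intervalIntegral.norm_integral_le_of_norm_le_const fun x hx => ?_
    rw [uIoc_of_le zero_le_one] at hx
    obtain ⟨hx0, hx1⟩ := hx
    have hxψ : x * ψ ≤ ψ := by nlinarith
    have hxψ0 : 0 ≤ x * ψ := by positivity
    have hgW := hW (t + x * ψ) ⟨by linarith, by linarith⟩
    have hη1 : |(1 - x) * η| ≤ H + 1 := by
      rw [abs_of_nonneg (mul_nonneg (by linarith) hη)]
      nlinarith
    have hψ1 : |(1 - x) * ψ| ≤ H + 1 := by
      rw [abs_of_nonneg (mul_nonneg (by linarith) hψ.le)]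
      nlinarith
    have hdiff : |(1 - x) * η - (1 - x) * ψ| ≤ ε := by
      rw [← mul_sub, abs_mul, abs_of_nonneg (by linarith : 0 ≤ 1 - x), abs_sub_comm]
      nlinarith [abs_nonneg (ψ - η)]
    have hrw : η • expFlow A ((1 - x) * η) (g (t + x * ψ)) -
        ψ • expFlow A ((1 - x) * ψ) (g (t + x * ψ)) =
        ψ • (expFlow A ((1 - x) * η) - expFlow A ((1 - x) * ψ)) (g (t + x * ψ)) -
        (ψ - η) • expFlow A ((1 - x) * η) (g (t + x * ψ)) := by
      rw [sub_apply, smul_sub, sub_smul]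
      abel
    rw [hrw]
    refine (norm_sub_le _ _).trans ?_
    rw [norm_smul, norm_smul, Real.norm_eq_abs, Real.norm_eq_abs, abs_of_pos hψ]
    have h1 : ‖(expFlow A ((1 - x) * η) - expFlow A ((1 - x) * ψ)) (g (t + x * ψ))‖ ≤
        (c₁ * ε) * W :=
      (ContinuousLinearMap.le_opNorm _ _).trans (mul_le_mul ((hc₁ _ _ hη1 hψ1).trans
        (mul_le_mul_of_nonneg_left hdiff hc₁0)) hgW (norm_nonneg _) (by positivity))
    have h2 : ‖expFlow A ((1 - x) * η) (g (t + x * ψ))‖ ≤ c₀ * W :=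
      (ContinuousLinearMap.le_opNorm _ _).trans (mul_le_mul (hc₀ _ hη1) hgW (norm_nonneg _) hc₀0)
    calc _ ≤ H * ((c₁ * ε) * W) + ε * (c₀ * W) :=
          add_le_add (mul_le_mul hψH h1 (norm_nonneg _) (by linarith))
            (mul_le_mul hηψ h2 (norm_nonneg _) hε0)
      _ = _ := by ring
  simpa using hb

end HorizonError

section Loop

variable {n m p : ℕ} {A : Matrix (Fin n) (Fin n) ℝ} {B : Matrix (Fin n) (Fin m) ℝ}
  {C : Matrix (Fin p) (Fin n) ℝ} {K : Matrix (Fin m) (Fin n) ℝ} {L : Matrix (Fin n) (Fin p) ℝ}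
  {D₁ D₂ : ℝ → ℝ}

/-- With horizon error at most `ε`, the input is the nominal feedback `K Z(φ₁⁻¹(t))` up to an error
of size `ε` relative to the current data, plus the reconstruction error. -/
lemma exists_feedback_error_le (h₁ : DelayPositiveBounded D₁) (h₁' : DelayInvertible D₁)
    (h₂ : DelayPositiveBounded D₂) :
    ∃ ε₀ > (0 : ℝ), ∃ c ≥ (0 : ℝ), ∀ ε ≤ ε₀, ∀ ψh : ℝ → ℝ,
      (∀ t, 0 ≤ t → |predictionHorizon D₁ t - ψh t| ≤ ε) →
      ∀ (Z : ℝ → Vec n) (U : ℝ → Vec m) (ξ : ℝ → Vec n),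
        IsClosedLoopSolution A B C L D₁ D₂ K ψh Z U ξ →
        ∀ t > 0, ∀ W, (∀ τ ∈ Icc (delayedTime D₁ t) t, ‖U τ‖ ≤ W) →
          ‖U t - act K (Z (delayedTimeInv D₁ t))‖ ≤
            c * (ε * (‖Z t‖ + W) + ‖Z t - reconstruction A B D₁ D₂ U ξ t‖) := by
  obtain ⟨π₀, hπ₀, hπ⟩ := h₁.exists_pos_le
  obtain ⟨H, hH0, hH⟩ := h₁.exists_le
  obtain ⟨c₀, hc₀1, hc₀⟩ := exists_norm_expFlow_le A (H + 1)
  obtain ⟨c₁, hc₁1, hc₁⟩ := exists_norm_expFlow_sub_le A (H + 1)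
  refine ⟨min π₀ 1, by positivity, ‖act K‖ * (c₀ + c₁ + (H * c₁ + c₀) * ‖act B‖), by positivity,
    fun ε hε ψh hψh Z U ξ hsol t ht W hW => ?_⟩
  have hφ0 : delayedTime D₁ 0 ≤ t := (h₁.delayedTime_lt le_rfl).le.trans ht.le
  set ψ := predictionHorizon D₁ t with hψdef
  have hinv : t + ψ = delayedTimeInv D₁ t := add_predictionHorizon D₁ t
  have hψD : ψ = D₁ (delayedTimeInv D₁ t) := h₁'.predictionHorizon_eq hφ0
  have hψπ : π₀ ≤ ψ := by rw [hψD]; exact hπ _ (h₁'.inv_nonneg hφ0)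
  have hψH : ψ ≤ H := by rw [hψD]; exact hH _ (h₁'.inv_nonneg hφ0)
  have hηψ : |ψ - ψh t| ≤ ε := hψh t ht.le
  have hη : 0 ≤ ψh t := by linarith [(abs_le.1 hηψ).2, hε.trans (min_le_left _ _)]
  have hε1 : ε ≤ 1 := hε.trans (min_le_right _ _)
  have hε0 : 0 ≤ ε := (abs_nonneg _).trans hηψ
  have ha : delayedTime D₂ 0 ≤ t := (h₂.delayedTime_lt le_rfl).le.trans ht.le
  have htψ : t ≤ t + ψ := by linarith
  have hstate := hsol.1.state_eq ha htψ
  rw [add_sub_cancel_left] at hstate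
  have hgi := hsol.1.intervalIntegrable_act_input ha htψ
  have hφ : ∀ s, t < s → (delayedTime D₁ s ≤ t ↔ s ≤ t + ψ) := by
    intro s hs
    rw [hinv, ← h₁'.strictMonoOn.le_iff_le (ht.trans hs).le (h₁'.inv_nonneg hφ0),
      h₁'.delayedTime_inv hφ0]
  have hgW : ∀ s ∈ Icc t (t + ψ), ‖act B (U (delayedTime D₁ s))‖ ≤ ‖act B‖ * W := by
    intro s hs
    refine ((act B).le_opNorm _).trans (mul_le_mul_of_nonneg_left (hW _ ⟨?_, ?_⟩) (norm_nonneg _))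
    · exact h₁'.strictMonoOn.monotoneOn ht.le (ht.le.trans hs.1) hs.1
    · rw [← h₁'.delayedTime_inv hφ0, ← hinv]
      exact h₁'.strictMonoOn.monotoneOn (ht.le.trans hs.1) (ht.le.trans htψ) hs.2
  -- `E` is the exact integral term; the integral term `I` of either implementation is close to it
  set E : Vec n := ∫ s in t..(t + ψ), expFlow A (t + ψ - s) (act B (U (delayedTime D₁ s))) with hE
  set X := reconstruction A B D₁ D₂ U ξ t with hX
  obtain ⟨I, hI, hU⟩ : ∃ I : Vec n, ‖I - E‖ ≤ (H * c₁ + c₀) * ε * (‖act B‖ * W) ∧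
      U t = act K (expFlow A (ψh t) X + I) := by
    rcases hsol.2 with h | h
    · exact ⟨_, norm_cutoff_integral_sub_le hgi hgW hφ (hπ₀.le.trans hψπ) hψH hη hηψ hε1 hc₀ hc₁,
        h t ht⟩
    · exact ⟨_, norm_distributed_integral_sub_le hgi hgW (hπ₀.trans_le hψπ) hψH hη hηψ hε1 hc₀ hc₁,
        h t ht⟩
  have hdec : U t - act K (Z (delayedTimeInv D₁ t)) =
      act K ((expFlow A (ψh t) - expFlow A ψ) (Z t) - expFlow A (ψh t) (Z t - X) + (I - E)) := by
    rw [← hinv, hU, hstate, ← map_sub, sub_apply, map_sub (expFlow A (ψh t))]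
    congr 1
    abel
  have hη1 : |ψh t| ≤ H + 1 := by
    rw [abs_of_nonneg hη]; linarith [(abs_le.1 hηψ).1]
  have hψ1 : |ψ| ≤ H + 1 := by
    rw [abs_of_nonneg (hπ₀.le.trans hψπ)]; linarith
  have hb1 : ‖(expFlow A (ψh t) - expFlow A ψ) (Z t)‖ ≤ c₁ * ε * ‖Z t‖ := by
    refine (ContinuousLinearMap.le_opNorm _ _).trans (mul_le_mul_of_nonneg_right
      ((hc₁ _ _ hη1 hψ1).trans (mul_le_mul_of_nonneg_left ?_ (by linarith))) (norm_nonneg _))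
    rwa [abs_sub_comm]
  have hb2 : ‖expFlow A (ψh t) (Z t - X)‖ ≤ c₀ * ‖Z t - X‖ :=
    (ContinuousLinearMap.le_opNorm _ _).trans
      (mul_le_mul_of_nonneg_right (hc₀ _ hη1) (norm_nonneg _))
  rw [hdec]
  refine ((act K).le_opNorm _).trans ?_
  rw [mul_assoc]
  refine mul_le_mul_of_nonneg_left ?_ (norm_nonneg _)
  refine (norm_add_le _ _).trans ((add_le_add ((norm_sub_le _ _).trans (add_le_add hb1 hb2))
    hI).trans ?_)
  have hW0 : 0 ≤ W := (norm_nonneg _).trans (hW t ⟨(h₁.delayedTime_lt ht.le).le, le_rfl⟩)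
  have e1 : 0 ≤ (c₀ + (H * c₁ + c₀) * ‖act B‖) * (ε * ‖Z t‖) := by positivity
  have e2 : 0 ≤ (c₀ + c₁) * (ε * W) := by positivity
  have e3 : 0 ≤ (c₁ + (H * c₁ + c₀) * ‖act B‖) * ‖Z t - X‖ := by positivity
  linarith

end Loop

/-! ### Decay estimates along solutions -/

section Decay

variable {n m p : ℕ} {A : Matrix (Fin n) (Fin n) ℝ} {B : Matrix (Fin n) (Fin m) ℝ}
  {C : Matrix (Fin p) (Fin n) ℝ} {K : Matrix (Fin m) (Fin n) ℝ} {L : Matrix (Fin n) (Fin p) ℝ}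
  {D₁ D₂ : ℝ → ℝ}

/-- The observer error decays in the time `φ₂(t)`, which lags behind `t` by a bounded amount. -/
lemma exists_reconstruction_error_le (hL : IsHurwitz (A - L * C))
    (h₂ : DelayPositiveBounded D₂) (h₂' : DelayInvertible D₂) :
    ∃ r > (0 : ℝ), ∃ c ≥ (0 : ℝ), ∀ (Z : ℝ → Vec n) (U : ℝ → Vec m) (ξ : ℝ → Vec n),
      PlantObserver A B C L D₁ D₂ Z U ξ → ∀ t, 0 ≤ t →
        ‖Z t - reconstruction A B D₁ D₂ U ξ t‖ ≤
          c * Real.exp (-r * t) * ‖Z 0 - reconstruction A B D₁ D₂ U ξ 0‖ := by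
  obtain ⟨k, hk1, r, hr, hk⟩ := hL.exists_norm_expFlow_le
  obtain ⟨H, hH0, hH⟩ := h₂.exists_le
  obtain ⟨c, hc1, hc⟩ := exists_norm_expFlow_le A H
  refine ⟨r, hr, c * k * Real.exp (r * H) * c, by positivity, fun Z U ξ h t ht => ?_⟩
  have hD : ∀ s, s - delayedTime D₂ s = D₂ s := fun s => by simp [delayedTime]
  have hDabs : ∀ s, 0 ≤ s → |D₂ s| ≤ H := fun s hs => by
    rw [abs_of_nonneg (h₂.nonneg s)]; exact hH s hs
  have h0 := h.state_sub_reconstruction h₂ h₂' le_rfl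
  have he0 : Z (delayedTime D₂ 0) - ξ 0 =
      expFlow A (-D₂ 0) (Z 0 - reconstruction A B D₁ D₂ U ξ 0) := by
    rw [h0, hD, expFlow_neg_apply_apply]
  rw [h.state_sub_reconstruction h₂ h₂' ht, h.observer_error_eq h₂' ht, he0, hD]
  set v := Z 0 - reconstruction A B D₁ D₂ U ξ 0
  have hlow : t - H ≤ delayedTime D₂ t - delayedTime D₂ 0 := by
    have := hH t ht
    have := h₂.nonneg 0
    unfold delayedTime
    linarith
  have hexp : ‖expFlow (A - L * C) (delayedTime D₂ t - delayedTime D₂ 0)‖ ≤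
      k * (Real.exp (r * H) * Real.exp (-r * t)) := by
    refine (hk _ (sub_nonneg.2 (h₂'.strictMonoOn.monotoneOn self_mem_Ici ht ht))).trans
      (mul_le_mul_of_nonneg_left ?_ (by linarith))
    rw [← Real.exp_add]
    refine Real.exp_le_exp.2 ?_
    nlinarith
  calc _ ≤ c * (k * (Real.exp (r * H) * Real.exp (-r * t)) * (c * ‖v‖)) := by
        refine ((expFlow A _).le_opNorm _).trans (mul_le_mul (hc _ (hDabs t ht)) ?_
          (norm_nonneg _) (by linarith))
        refine (ContinuousLinearMap.le_opNorm _ _).trans (mul_le_mul hexp ?_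
          (norm_nonneg _) (by positivity))
        exact (ContinuousLinearMap.le_opNorm _ _).trans
          (mul_le_mul_of_nonneg_right (hc _ (by rw [abs_neg]; exact hDabs 0 le_rfl))
            (norm_nonneg _))
    _ = _ := by ring

/-- Until the time `φ₁⁻¹(0)` at which the feedback reaches the plant, the state is controlled by
the initial data. -/
lemma exists_initial_state_le (A : Matrix (Fin n) (Fin n) ℝ) (B : Matrix (Fin n) (Fin m) ℝ)
    (h₁ : DelayPositiveBounded D₁) (h₁' : DelayInvertible D₁) (h₂ : DelayPositiveBounded D₂) :
    ∃ c ≥ (1 : ℝ), ∀ (Z : ℝ → Vec n) (U : ℝ → Vec m) (ξ : ℝ → Vec n),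
      PlantObserver A B C L D₁ D₂ Z U ξ → ∀ G, ‖Z 0‖ ≤ G →
        (∀ τ ∈ Icc (delayedTime D₁ 0) 0, ‖U τ‖ ≤ G) →
        ∀ s ∈ Icc 0 (delayedTimeInv D₁ 0), ‖Z s‖ ≤ c * G := by
  have hφ0 := (h₁.delayedTime_lt le_rfl).le
  have hσ0 := h₁'.inv_nonneg hφ0
  set σ := delayedTimeInv D₁ 0 with hσ
  obtain ⟨c, hc1, hc⟩ := exists_norm_expFlow_le A σ
  refine ⟨c + c * ‖act B‖ * σ, ?_, fun Z U ξ h G hZ hU s hs => ?_⟩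
  · have : 0 ≤ c * ‖act B‖ * σ := by positivity
    linarith
  have hG : 0 ≤ G := (norm_nonneg _).trans hZ
  rw [h.state_eq (h₂.delayedTime_lt le_rfl).le hs.1, sub_zero]
  have h1 : ‖expFlow A s (Z 0)‖ ≤ c * G :=
    (ContinuousLinearMap.le_opNorm _ _).trans (mul_le_mul
      (hc _ (by rw [abs_of_nonneg hs.1]; exact hs.2)) hZ (norm_nonneg _) (by linarith))
  have h2 : ‖∫ τ in (0 : ℝ)..s, expFlow A (s - τ) (act B (U (delayedTime D₁ τ)))‖ ≤
      c * (‖act B‖ * G) * |s - 0| := by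
    refine intervalIntegral.norm_integral_le_of_norm_le_const fun τ hτ => ?_
    rw [uIoc_of_le hs.1] at hτ
    refine (ContinuousLinearMap.le_opNorm _ _).trans (mul_le_mul
      (hc _ (abs_le.2 ⟨by linarith [hτ.2], by linarith [hτ.1, hs.2]⟩)) ?_ (norm_nonneg _)
      (by linarith))
    refine ((act B).le_opNorm _).trans (mul_le_mul_of_nonneg_left (hU _ ⟨?_, ?_⟩) (norm_nonneg _))
    · exact h₁'.strictMonoOn.monotoneOn self_mem_Ici hτ.1.le hτ.1.le
    · rw [← h₁'.delayedTime_inv hφ0]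
      exact h₁'.strictMonoOn.monotoneOn hτ.1.le hσ0 (hτ.2.trans hs.2)
  rw [sub_zero, abs_of_nonneg hs.1] at h2
  refine (norm_add_le _ _).trans ((add_le_add h1 h2).trans ?_)
  have : c * (‖act B‖ * G) * s ≤ c * (‖act B‖ * G) * σ :=
    mul_le_mul_of_nonneg_left hs.2 (by positivity)
  linarith

/-- The plant as a perturbation of the nominal closed loop `Z' = (A + BK) Z`. -/
lemma PlantObserver.state_eq_closed_loop {Z : ℝ → Vec n} {U : ℝ → Vec m} {ξ : ℝ → Vec n}
    (h : PlantObserver A B C L D₁ D₂ Z U ξ) (K : Matrix (Fin m) (Fin n) ℝ) {a t : ℝ}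
    (ha : delayedTime D₂ 0 ≤ a) (hat : a ≤ t) :
    Z t = expFlow (A + B * K) (t - a) (Z a) + ∫ τ in a..t,
      expFlow (A + B * K) (t - τ) (act B (U (delayedTime D₁ τ) - act K (Z τ))) := by
  have hZc : ContinuousOn Z (Icc a t) := h.state_continuous.mono fun _ hs => ha.trans hs.1
  have hKZ : IntervalIntegrable (fun τ => act K (Z τ)) volume a t := by
    refine ((act K).continuous.comp_continuousOn ?_).intervalIntegrable
    rwa [uIcc_of_le hat]
  refine variation_of_constants (A + B * K)
    (f := fun τ => act B (U (delayedTime D₁ τ) - act K (Z τ))) hat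
    (((h.intervalIntegrable_input ha hat).sub hKZ).clm_apply_of_continuous (P := fun _ => act B)
      continuous_const) hZc fun s hs => ?_
  rw [h.state_integral_eq ha hs.1]
  congr 1
  refine intervalIntegral.integral_congr fun τ _ => ?_
  rw [act_add, add_apply, act_mul_apply, map_sub]
  abel

/-- Convolution of a kernel of decay rate `2c` with a signal of decay rate `c`. -/
lemma norm_integral_expFlow_le {M : Matrix (Fin n) (Fin n) ℝ} {f : ℝ → Vec n} {a t k c δ : ℝ}
    (hat : a ≤ t) (hc : 0 < c) (hk : 0 ≤ k) (hδ : 0 ≤ δ)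
    (hM : ∀ s, 0 ≤ s → ‖expFlow M s‖ ≤ k * Real.exp (-(2 * c) * s))
    (hf : ∀ s ∈ Ioc a t, ‖f s‖ ≤ δ * Real.exp (-c * s)) :
    ‖∫ s in a..t, expFlow M (t - s) (f s)‖ ≤ k * δ / c * Real.exp (-c * t) := by
  set g : ℝ → ℝ := fun s => k * δ * Real.exp (-(2 * c) * t) * Real.exp (c * s) with hg
  have hgc : Continuous g := by fun_prop
  have h1 := intervalIntegral.norm_integral_le_of_norm_le (μ := volume)
    (f := fun s => expFlow M (t - s) (f s)) (g := g) hat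
    (Eventually.of_forall fun s hs => ?_) (hgc.intervalIntegrable _ _)
  · have h2 : ∫ s in a..t, g s = k * δ * Real.exp (-(2 * c) * t) * (Real.exp (c * t) / c) -
        k * δ * Real.exp (-(2 * c) * t) * (Real.exp (c * a) / c) := by
      refine intervalIntegral.integral_eq_sub_of_hasDerivAt
        (f := fun s => k * δ * Real.exp (-(2 * c) * t) * (Real.exp (c * s) / c))
        (fun s _ => ?_) (hgc.intervalIntegrable _ _)
      have h3 := (((hasDerivAt_id s).const_mul c).exp.div_const c).const_mul
        (k * δ * Real.exp (-(2 * c) * t))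
      convert! h3 using 1
      simp only [hg, id]
      field_simp
    refine h1.trans ?_
    have h4 : Real.exp (-(2 * c) * t) * Real.exp (c * t) = Real.exp (-c * t) := by
      rw [← Real.exp_add]; congr 1; ring
    have h5 : 0 ≤ k * δ * Real.exp (-(2 * c) * t) * (Real.exp (c * a) / c) := by positivity
    have h6 : k * δ * Real.exp (-(2 * c) * t) * (Real.exp (c * t) / c) =
        k * δ / c * Real.exp (-c * t) := by
      rw [← h4]; ring
    linarith
  · refine (ContinuousLinearMap.le_opNorm _ _).trans ((mul_le_mul (hM _ (by linarith [hs.2]))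
      (hf s hs) (norm_nonneg _) (by positivity)).trans (le_of_eq ?_))
    have : Real.exp (-(2 * c) * (t - s)) * Real.exp (-c * s) =
        Real.exp (-(2 * c) * t) * Real.exp (c * s) := by
      rw [← Real.exp_add, ← Real.exp_add]; congr 1; ring
    simp only [hg]
    linear_combination k * δ * this

/-- A feedback error of weighted size `δ` after time `a` keeps the weighted norm of the state
bounded. -/
lemma PlantObserver.norm_state_le {Z : ℝ → Vec n} {U : ℝ → Vec m} {ξ : ℝ → Vec n}
    (h : PlantObserver A B C L D₁ D₂ Z U ξ) {a t k c δ z : ℝ}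
    (ha : delayedTime D₂ 0 ≤ a) (hat : a ≤ t) (hc : 0 < c) (hk : 0 ≤ k) (hδ : 0 ≤ δ)
    (hM : ∀ s, 0 ≤ s → ‖expFlow (A + B * K) s‖ ≤ k * Real.exp (-(2 * c) * s))
    (hz : ‖Z a‖ ≤ z)
    (hU : ∀ s ∈ Ioc a t, ‖U (delayedTime D₁ s) - act K (Z s)‖ ≤ δ * Real.exp (-c * s)) :
    ‖Z t‖ ≤ (k * Real.exp (c * a) * z + k * ‖act B‖ / c * δ) * Real.exp (-c * t) := by
  rw [h.state_eq_closed_loop K ha hat]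
  have h1 : ‖expFlow (A + B * K) (t - a) (Z a)‖ ≤
      k * (Real.exp (c * a) * Real.exp (-c * t)) * z := by
    refine (ContinuousLinearMap.le_opNorm _ _).trans
      (mul_le_mul ((hM _ (sub_nonneg.2 hat)).trans ?_) hz (norm_nonneg _) (by positivity))
    rw [← Real.exp_add]
    exact mul_le_mul_of_nonneg_left (Real.exp_le_exp.2 (by nlinarith)) hk
  have h2 := norm_integral_expFlow_le (M := A + B * K)
    (f := fun τ => act B (U (delayedTime D₁ τ) - act K (Z τ))) (δ := ‖act B‖ * δ) hat hc
    hk (by positivity) hM fun s hs => ?_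
  · exact (norm_add_le _ _).trans ((add_le_add h1 h2).trans (le_of_eq (by ring)))
  · exact ((act B).le_opNorm _).trans
      ((mul_le_mul_of_nonneg_left (hU s hs) (norm_nonneg _)).trans (le_of_eq (by ring)))

/-- Passing between a weighted bound and exponential decay. -/
lemma exp_mul_le_iff_le_mul_exp_neg {c s x y : ℝ} :
    Real.exp (c * s) * x ≤ y ↔ x ≤ y * Real.exp (-c * s) := by
  rw [neg_mul, Real.exp_neg, ← div_eq_mul_inv, le_div_iff₀' (Real.exp_pos _)]

/-- Algebra of the small-gain argument: `N` and `V` are the weighted norms of the state and of the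
input, and `δ` that of the feedback error, whose dependence on `N` and `V` carries the small
factor `ε`. -/
lemma add_le_of_small_gain {N V G δ a₁ a₂ κ d e w ε : ℝ} (hN : 0 ≤ N) (hV : 0 ≤ V) (ha₂ : 0 ≤ a₂)
    (hκ : 0 ≤ κ) (hd : 0 ≤ d) (hw : 1 ≤ w) (hε : 0 ≤ ε)
    (hNle : N ≤ a₁ * G + a₂ * δ) (hVle : V ≤ G + κ * N + δ)
    (hδ : δ = d * (ε * (N + w * V) + e * G))
    (hsmall : (1 + (1 + κ) * a₂) * d * w * ε ≤ 1 / 2) :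
    N + V ≤ 2 * (1 + (1 + κ) * a₁ + (1 + (1 + κ) * a₂) * d * e) * G := by
  set b := 1 + (1 + κ) * a₂ with hb
  have hb0 : 0 ≤ b := by positivity
  have h1 : N + V ≤ (1 + (1 + κ) * a₁) * G + b * δ := by
    have := mul_le_mul_of_nonneg_left hNle (by positivity : 0 ≤ 1 + κ)
    linarith
  have h2 : N + w * V ≤ w * (N + V) := by nlinarith
  have h3 : b * d * ε * (N + w * V) ≤ b * d * ε * (w * (N + V)) :=
    mul_le_mul_of_nonneg_left h2 (by positivity)
  have h4 := mul_le_mul_of_nonneg_right hsmall (add_nonneg hN hV)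
  rw [hδ] at h1
  linarith

set_option maxHeartbeats 800000 in
/-- The small-gain estimate: for small horizon errors, the state, the reconstruction error and the
input decay exponentially, with rate and gain independent of the horizon error. -/
lemma exists_exponential_bound (hK : IsHurwitz (A + B * K)) (hL : IsHurwitz (A - L * C))
    (h₁ : DelayPositiveBounded D₁) (h₂ : DelayPositiveBounded D₂)
    (h₁' : DelayInvertible D₁) (h₂' : DelayInvertible D₂) :
    ∃ εs > (0 : ℝ), ∃ c > (0 : ℝ), ∃ M > (0 : ℝ), ∀ ε ∈ Ioo 0 εs, ∀ ψh : ℝ → ℝ,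
      (∀ t, 0 ≤ t → |predictionHorizon D₁ t - ψh t| ≤ ε) →
      ∀ (Z : ℝ → Vec n) (U : ℝ → Vec m) (ξ : ℝ → Vec n),
        IsClosedLoopSolution A B C L D₁ D₂ K ψh Z U ξ →
        ∀ G, ‖Z 0‖ ≤ G → ‖Z 0 - reconstruction A B D₁ D₂ U ξ 0‖ ≤ G →
          (∀ τ ∈ Icc (delayedTime D₁ 0) 0, ‖U τ‖ ≤ G) → ∀ T, 0 ≤ T →
            ‖Z T‖ ≤ M * G * Real.exp (-c * T) ∧
            ‖Z T - reconstruction A B D₁ D₂ U ξ T‖ ≤ M * G * Real.exp (-c * T) ∧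
            ∀ τ ∈ Icc (delayedTime D₁ 0) T, ‖U τ‖ ≤ M * G * Real.exp (-c * τ) := by
  obtain ⟨k, hk1, rK, hrK, hk⟩ := hK.exists_norm_expFlow_le
  obtain ⟨rL, hrL, ce, hce, he⟩ := exists_reconstruction_error_le (m := m) (B := B) (D₁ := D₁)
    hL h₂ h₂'
  obtain ⟨ε₀, hε₀, cd, hcd, hd⟩ := exists_feedback_error_le (A := A) (B := B) (C := C) (K := K)
    (L := L) h₁ h₁' h₂
  obtain ⟨c₀, hc₀1, hc₀⟩ := exists_initial_state_le (C := C) (L := L) A B h₁ h₁' h₂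
  obtain ⟨H, hH0, hH⟩ := h₁.exists_le
  have hφ0 := (h₁.delayedTime_lt le_rfl).le
  have hσ0 := h₁'.inv_nonneg hφ0
  set σ := delayedTimeInv D₁ 0 with hσ
  set c := min rK rL / 2 with hc
  have hc0 : 0 < c := by positivity
  have hcK : 2 * c ≤ rK := by rw [hc]; linarith [min_le_left rK rL]
  have hcL : c ≤ rL := by linarith [min_le_right rK rL]
  have hkc : ∀ s, 0 ≤ s → ‖expFlow (A + B * K) s‖ ≤ k * Real.exp (-(2 * c) * s) := fun s hs =>
    (hk s hs).trans (mul_le_mul_of_nonneg_left (Real.exp_le_exp.2 (by nlinarith)) (by linarith))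
  -- `w` is the cost of a delay in the weighted norm; the weighted norm of the state will be at most
  -- `a₁ G + a₂ δ`, where `δ` bounds the weighted feedback error
  set w := Real.exp (c * H) with hw
  have hw1 : 1 ≤ w := Real.one_le_exp (by positivity)
  set a₁ := k * Real.exp (c * σ) * c₀ with ha₁
  set a₂ := k * (‖act B‖ * w) / c with ha₂
  have ha₁0 : 0 ≤ a₁ := by positivity
  have ha₂0 : 0 ≤ a₂ := by positivity
  set γ := (1 + (1 + ‖act K‖) * a₂) * cd * w with hγ
  have hγ0 : 0 ≤ γ := by positivity
  set b := 2 * (1 + (1 + ‖act K‖) * a₁ + (1 + (1 + ‖act K‖) * a₂) * cd * ce) with hb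
  have hb0 : 0 < b := by positivity
  refine ⟨min ε₀ (1 / (2 * γ + 1)), by positivity, c, hc0, b + ce, by positivity,
    fun ε hε ψh hψh Z U ξ hsol G hZG hXG hUG T hT => ?_⟩
  have hε0 : 0 < ε := hε.1
  have hεγ : γ * ε ≤ 1 / 2 := by
    have h1 : ε ≤ 1 / (2 * γ + 1) := hε.2.le.trans (min_le_right _ _)
    rw [le_div_iff₀ (by positivity)] at h1
    nlinarith
  have hG : 0 ≤ G := (norm_nonneg _).trans hZG
  have hinvT : 0 ≤ delayedTimeInv D₁ T := h₁'.inv_nonneg (hφ0.trans hT)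
  have hTinv : ∀ t, 0 ≤ t → t ≤ delayedTimeInv D₁ t := fun t ht => by
    have h1 := h₁.delayedTime_lt (h₁'.inv_nonneg (hφ0.trans ht))
    rw [h₁'.delayedTime_inv (hφ0.trans ht)] at h1
    exact h1.le
  set S := delayedTimeInv D₁ T with hS
  -- the weighted norms of the state on `[0, S]` and of the input on `[φ₁(0), T]`
  obtain ⟨s₀, hs₀, hmax⟩ := (isCompact_Icc (a := (0 : ℝ)) (b := S)).exists_isMaxOn
    ⟨0, le_rfl, hinvT⟩ (f := fun s => Real.exp (c * s) * ‖Z s‖)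
    ((by fun_prop : Continuous fun s => Real.exp (c * s)).continuousOn.mul
      (hsol.1.state_continuous.mono fun s hs =>
        (h₂.delayedTime_lt le_rfl).le.trans hs.1).norm)
  set N := Real.exp (c * s₀) * ‖Z s₀‖ with hN
  have hN0 : 0 ≤ N := by positivity
  have hZN : ∀ s ∈ Icc 0 S, Real.exp (c * s) * ‖Z s‖ ≤ N := fun s hs => hmax hs
  set V := sSup ((fun τ => Real.exp (c * τ) * ‖U τ‖) '' Icc (delayedTime D₁ 0) T) with hV
  have hbdd : BddAbove ((fun τ => Real.exp (c * τ) * ‖U τ‖) '' Icc (delayedTime D₁ 0) T) := by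
    obtain ⟨b, hb⟩ := hsol.1.input_bounded T
    refine ⟨Real.exp (c * T) * b, ?_⟩
    rintro _ ⟨τ, hτ, rfl⟩
    exact mul_le_mul (Real.exp_le_exp.2 (mul_le_mul_of_nonneg_left hτ.2 hc0.le))
      (hb (mem_image_of_mem _ hτ)) (norm_nonneg _) (Real.exp_pos _).le
  have hUV : ∀ τ ∈ Icc (delayedTime D₁ 0) T, Real.exp (c * τ) * ‖U τ‖ ≤ V := fun τ hτ =>
    le_csSup hbdd (mem_image_of_mem _ hτ)
  have hV0 : 0 ≤ V := le_trans (by positivity) (hUV 0 ⟨hφ0, hT⟩)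
  have hdelay : ∀ s, 0 ≤ s → Real.exp (-c * delayedTime D₁ s) ≤ w * Real.exp (-c * s) := by
    intro s hs
    rw [hw, ← Real.exp_add]
    refine Real.exp_le_exp.2 ?_
    have := hH s hs
    unfold delayedTime
    nlinarith
  have hX : ∀ t, 0 ≤ t → ‖Z t - reconstruction A B D₁ D₂ U ξ t‖ ≤
      ce * G * Real.exp (-c * t) := by
    intro t ht
    refine (he Z U ξ hsol.1 t ht).trans ?_
    have h1 : Real.exp (-rL * t) ≤ Real.exp (-c * t) := Real.exp_le_exp.2 (by nlinarith)
    calc ce * Real.exp (-rL * t) * ‖Z 0 - reconstruction A B D₁ D₂ U ξ 0‖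
        ≤ ce * Real.exp (-c * t) * G :=
          mul_le_mul (mul_le_mul_of_nonneg_left h1 hce) hXG (norm_nonneg _) (by positivity)
      _ = _ := by ring
  -- `δ` bounds the weighted feedback error on `(0, T]`
  set δ := cd * (ε * (N + w * V) + ce * G) with hδ
  have hδ0 : 0 ≤ δ := by positivity
  have hdδ : ∀ t, 0 < t → t ≤ T →
      ‖U t - act K (Z (delayedTimeInv D₁ t))‖ ≤ δ * Real.exp (-c * t) := by
    intro t ht htT
    refine (hd ε (hε.2.le.trans (min_le_left _ _)) ψh hψh Z U ξ hsol t ht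
      (w * V * Real.exp (-c * t)) fun τ hτ => ?_).trans ?_
    · have hτ0 : delayedTime D₁ 0 ≤ τ :=
        (h₁'.strictMonoOn.monotoneOn self_mem_Ici ht.le ht.le).trans hτ.1
      calc ‖U τ‖ ≤ V * Real.exp (-c * τ) :=
            exp_mul_le_iff_le_mul_exp_neg.1 (hUV τ ⟨hτ0, hτ.2.trans htT⟩)
        _ ≤ V * (w * Real.exp (-c * t)) := by
          refine mul_le_mul_of_nonneg_left ((Real.exp_le_exp.2 ?_).trans (hdelay t ht.le)) hV0
          nlinarith [hτ.1]
        _ = _ := by ring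
    · have h1 : ‖Z t‖ ≤ N * Real.exp (-c * t) :=
        exp_mul_le_iff_le_mul_exp_neg.1 (hZN t ⟨ht.le, htT.trans (hTinv T hT)⟩)
      have h2 := hX t ht.le
      calc _ ≤ cd * (ε * (N * Real.exp (-c * t) + w * V * Real.exp (-c * t)) +
            ce * G * Real.exp (-c * t)) := by gcongr
        _ = _ := by ring
  -- the state before and after the time `σ`
  have hinit : ∀ s ∈ Icc 0 σ, Real.exp (c * s) * ‖Z s‖ ≤ Real.exp (c * σ) * (c₀ * G) :=
    fun s hs => mul_le_mul (Real.exp_le_exp.2 (mul_le_mul_of_nonneg_left hs.2 hc0.le))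
      (hc₀ Z U ξ hsol.1 G hZG hUG s hs) (norm_nonneg _) (Real.exp_pos _).le
  have hNle : N ≤ a₁ * G + a₂ * δ := by
    rcases le_total s₀ σ with h | h
    · refine (hinit s₀ ⟨hs₀.1, h⟩).trans ?_
      have h1 : Real.exp (c * σ) * (c₀ * G) ≤ k * (Real.exp (c * σ) * (c₀ * G)) :=
        le_mul_of_one_le_left (by positivity) hk1
      have h2 : 0 ≤ a₂ * δ := by positivity
      rw [ha₁]
      linarith
    · have hz : ‖Z σ‖ ≤ c₀ * G := hc₀ Z U ξ hsol.1 G hZG hUG σ ⟨hσ0, le_rfl⟩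
      have h1 := hsol.1.norm_state_le (K := K) (δ := w * δ)
        ((h₂.delayedTime_lt le_rfl).le.trans hσ0) h hc0 (zero_le_one.trans hk1) (by positivity)
        hkc hz fun s hs => ?_
      · refine (exp_mul_le_iff_le_mul_exp_neg.2 h1).trans (le_of_eq ?_)
        rw [ha₁, ha₂]; ring
      · have hs0 : 0 ≤ s := hσ0.trans hs.1.le
        have hpos : 0 < delayedTime D₁ s := by
          have := h₁'.strictMonoOn hσ0 hs0 hs.1
          rwa [h₁'.delayedTime_inv hφ0] at this
        have hleT : delayedTime D₁ s ≤ T := by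
          rw [← h₁'.delayedTime_inv (hφ0.trans hT)]
          exact h₁'.strictMonoOn.monotoneOn hs0 hinvT (hs.2.trans hs₀.2)
        have h5 := hdδ _ hpos hleT
        rw [h₁'.inv_delayedTime hs0] at h5
        exact h5.trans ((mul_le_mul_of_nonneg_left (hdelay s hs0) hδ0).trans (le_of_eq (by ring)))
  have hVle : V ≤ G + ‖act K‖ * N + δ := by
    refine csSup_le ⟨_, mem_image_of_mem _ (⟨hφ0, hT⟩ : (0 : ℝ) ∈ Icc (delayedTime D₁ 0) T)⟩ ?_
    rintro _ ⟨τ, hτ, rfl⟩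
    rcases le_or_gt τ 0 with h | h
    · have h1 : Real.exp (c * τ) ≤ 1 := Real.exp_le_one_iff.2 (by nlinarith)
      have h2 : Real.exp (c * τ) * ‖U τ‖ ≤ 1 * G :=
        mul_le_mul h1 (hUG τ ⟨hτ.1, h⟩) (norm_nonneg _) zero_le_one
      have h3 : 0 ≤ ‖act K‖ * N := by positivity
      change Real.exp (c * τ) * ‖U τ‖ ≤ _
      linarith
    · have h1 := exp_mul_le_iff_le_mul_exp_neg.2 (hdδ τ h hτ.2)
      have h2 : Real.exp (c * τ) * ‖Z (delayedTimeInv D₁ τ)‖ ≤ N := by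
        refine le_trans (mul_le_mul_of_nonneg_right (Real.exp_le_exp.2
          (mul_le_mul_of_nonneg_left (hTinv τ h.le) hc0.le)) (norm_nonneg _))
          (hZN _ ⟨h₁'.inv_nonneg hτ.1, h₁'.inv_mono hτ.1 hτ.2⟩)
      have h3 : ‖U τ‖ ≤ ‖act K‖ * ‖Z (delayedTimeInv D₁ τ)‖ +
          ‖U τ - act K (Z (delayedTimeInv D₁ τ))‖ := by
        have h4 := norm_add_le (act K (Z (delayedTimeInv D₁ τ)))
          (U τ - act K (Z (delayedTimeInv D₁ τ)))
        rw [add_sub_cancel] at h4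
        exact h4.trans (add_le_add ((act K).le_opNorm _) le_rfl)
      have h5 := mul_le_mul_of_nonneg_left h3 (Real.exp_pos (c * τ)).le
      have h6 := mul_le_mul_of_nonneg_left h2 (norm_nonneg (act K))
      change Real.exp (c * τ) * ‖U τ‖ ≤ _
      linarith
  have hNV : N + V ≤ b * G :=
    add_le_of_small_gain hN0 hV0 ha₂0 (norm_nonneg _) hcd hw1 hε0.le hNle hVle hδ hεγ
  have hceG : 0 ≤ ce * G := by positivity
  have hbG : 0 ≤ b * G := by positivity
  refine ⟨exp_mul_le_iff_le_mul_exp_neg.1 ((hZN T ⟨hT, hTinv T hT⟩).trans (by linarith)),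
    (hX T hT).trans (mul_le_mul_of_nonneg_right (by linarith) (Real.exp_pos _).le),
    fun τ hτ => exp_mul_le_iff_le_mul_exp_neg.1 ((hUV τ hτ).trans (by linarith))⟩

end Decay

theorem theorem3 {n m p : ℕ}
    (A : Matrix (Fin n) (Fin n) ℝ) (B : Matrix (Fin n) (Fin m) ℝ)
    (C : Matrix (Fin p) (Fin n) ℝ) (K : Matrix (Fin m) (Fin n) ℝ)
    (L : Matrix (Fin n) (Fin p) ℝ) (D₁ D₂ : ℝ → ℝ)
    (hK : IsHurwitz (A + B * K)) (hL : IsHurwitz (A - L * C))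
    (h₁ : DelayPositiveBounded D₁) (h₂ : DelayPositiveBounded D₂)
    (h₁' : DelayInvertible D₁) (h₂' : DelayInvertible D₂) :
    ∃ εs > (0 : ℝ), ∃ M > (0 : ℝ), ∃ rate : ℝ → ℝ,
      (∀ ε ∈ Set.Ioo 0 εs, 0 < rate ε) ∧ StrictAntiOn rate (Set.Ioo 0 εs) ∧
      ∀ ε ∈ Set.Ioo 0 εs, ∀ ψh : ℝ → ℝ,
        (∀ t, 0 ≤ t → |predictionHorizon D₁ t - ψh t| ≤ ε) →
        ∀ (Z : ℝ → Vec n) (U : ℝ → Vec m) (ξ : ℝ → Vec n),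
          IsClosedLoopSolution A B C L D₁ D₂ K ψh Z U ξ →
          ∀ t, 0 ≤ t →
            Gam A B D₁ D₂ Z U ξ t ≤
              M * Real.exp (-(rate ε) * t) * Gam A B D₁ D₂ Z U ξ 0 := by
  obtain ⟨εs, hεs, c, hc, M, hM, hmain⟩ := exists_exponential_bound hK hL h₁ h₂ h₁' h₂'
  obtain ⟨H, hH0, hH⟩ := h₁.exists_le
  -- the decay rate `2c` is uniform in `ε`, so any strictly decreasing positive minorant will do
  refine ⟨εs, hεs, M ^ 2 * (2 + Real.exp (2 * c * H)), by positivity,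
    fun ε => 2 * c * (1 - ε / (2 * εs)), fun ε hε => ?_, fun x hx y hy hxy => ?_,
    fun ε hε ψh hψh Z U ξ hsol t ht => ?_⟩
  · have : ε / (2 * εs) < 1 := (div_lt_one (by positivity)).2 (by linarith [hε.1, hε.2])
    have h2 : 0 < 1 - ε / (2 * εs) := by linarith
    positivity
  · have : x / (2 * εs) < y / (2 * εs) := div_lt_div_of_pos_right hxy (by positivity)
    have h2 : 0 < 2 * c := by positivity
    change 2 * c * (1 - y / (2 * εs)) < 2 * c * (1 - x / (2 * εs))
    nlinarith
  have hφ0 := (h₁.delayedTime_lt le_rfl).le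
  set Γ₀ := Gam A B D₁ D₂ Z U ξ 0 with hΓ₀
  have hbdd : BddAbove ((fun τ => ‖U τ‖ ^ 2) '' Icc (delayedTime D₁ 0) 0) := by
    obtain ⟨b, hb⟩ := hsol.1.input_bounded 0
    refine ⟨b ^ 2, ?_⟩
    rintro _ ⟨τ, hτ, rfl⟩
    exact pow_le_pow_left₀ (norm_nonneg _) (hb (mem_image_of_mem _ hτ)) 2
  have hsup : ∀ τ ∈ Icc (delayedTime D₁ 0) 0,
      ‖U τ‖ ^ 2 ≤ sSup ((fun τ => ‖U τ‖ ^ 2) '' Icc (delayedTime D₁ 0) 0) := fun τ hτ =>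
    le_csSup hbdd (mem_image_of_mem _ hτ)
  have hsup0 : 0 ≤ sSup ((fun τ => ‖U τ‖ ^ 2) '' Icc (delayedTime D₁ 0) 0) :=
    (sq_nonneg _).trans (hsup 0 ⟨hφ0, le_rfl⟩)
  have hΓ : Γ₀ = ‖Z 0‖ ^ 2 + ‖Z 0 - reconstruction A B D₁ D₂ U ξ 0‖ ^ 2 +
      sSup ((fun τ => ‖U τ‖ ^ 2) '' Icc (delayedTime D₁ 0) 0) := rfl
  have hs1 := sq_nonneg ‖Z 0‖
  have hs2 := sq_nonneg ‖Z 0 - reconstruction A B D₁ D₂ U ξ 0‖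
  have hΓ0 : 0 ≤ Γ₀ := by rw [hΓ]; positivity
  have hb := hmain ε hε ψh hψh Z U ξ hsol (Real.sqrt Γ₀) (Real.le_sqrt_of_sq_le (by linarith))
    (Real.le_sqrt_of_sq_le (by linarith))
    (fun τ hτ => Real.le_sqrt_of_sq_le (by linarith [hsup τ hτ])) t ht
  obtain ⟨hZ, hX, hU⟩ := hb
  have hsq : ∀ {x s : ℝ}, 0 ≤ x → x ≤ M * Real.sqrt Γ₀ * Real.exp (-c * s) →
      x ^ 2 ≤ M ^ 2 * Γ₀ * Real.exp (-(2 * c) * s) := by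
    intro x s hx h
    refine (pow_le_pow_left₀ hx h 2).trans (le_of_eq ?_)
    rw [mul_pow, mul_pow, Real.sq_sqrt hΓ0, ← Real.exp_nat_mul]
    congr 2
    push_cast
    ring
  have h3 : sSup ((fun τ => ‖U τ‖ ^ 2) '' Icc (delayedTime D₁ t) t) ≤
      M ^ 2 * Γ₀ * (Real.exp (2 * c * H) * Real.exp (-(2 * c) * t)) := by
    refine csSup_le ⟨_, mem_image_of_mem _
      (⟨(h₁.delayedTime_lt ht).le, le_rfl⟩ : t ∈ Icc (delayedTime D₁ t) t)⟩ ?_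
    rintro _ ⟨τ, hτ, rfl⟩
    refine (hsq (norm_nonneg _) (hU τ ⟨(h₁'.strictMonoOn.monotoneOn self_mem_Ici ht ht).trans hτ.1,
      hτ.2⟩)).trans (mul_le_mul_of_nonneg_left ?_ (by positivity))
    rw [← Real.exp_add]
    refine Real.exp_le_exp.2 ?_
    have h4 := hτ.1
    have h5 := hH t ht
    unfold delayedTime at h4
    nlinarith
  have h4 : Real.exp (-(2 * c) * t) ≤ Real.exp (-(2 * c * (1 - ε / (2 * εs))) * t) := by
    refine Real.exp_le_exp.2 ?_
    have : 0 ≤ 2 * c * (ε / (2 * εs)) * t := by have := hε.1; positivity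
    linarith
  calc Gam A B D₁ D₂ Z U ξ t
      ≤ M ^ 2 * Γ₀ * Real.exp (-(2 * c) * t) + M ^ 2 * Γ₀ * Real.exp (-(2 * c) * t) +
        M ^ 2 * Γ₀ * (Real.exp (2 * c * H) * Real.exp (-(2 * c) * t)) :=
        add_le_add (add_le_add (hsq (norm_nonneg _) hZ) (hsq (norm_nonneg _) hX)) h3
    _ = M ^ 2 * (2 + Real.exp (2 * c * H)) * Γ₀ * Real.exp (-(2 * c) * t) := by ring
    _ ≤ M ^ 2 * (2 + Real.exp (2 * c * H)) * Γ₀ *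
        Real.exp (-(2 * c * (1 - ε / (2 * εs))) * t) :=
        mul_le_mul_of_nonneg_left h4 (by positivity)
    _ = _ := by ring
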